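/- **Setting.** Let $E\subset\mathbb R^2$ be the regular hexagon with side length $1$, centred at the origin, with two horizontal sides. Label the pairs of opposite sides $A$ (horizontal), $B$, $C$ clockwise, starting from the top side. Let $S_E$ be the translation surface obtained by gluing opposite sides of $E$ by translations; its singular points are the images of the vertices. A trajectory $\tau$ in direction $\theta$ is a bi-infinite straight line in $S_E$ that never hits a singular point, and its cutting sequence is the bi-infinite word in $\{A,B,C\}$ (up to a shift of the index) of the labels of the sides it hits. A word is *admissible* if it is a bi-infinite path in one of six diagrams $\mathscr D_i$, $0\le i\le 5$. Each has the shape $x\rightleftarrows y\rightleftarrows z$ with a loop at $z$, where $(x,y,z)$ is $(A,C,B)$, $(C,A,B)$, $(C,B,A)$, $(B,C,A)$, $(B,A,C)$, $(A,B,C)$ for $i=0,\dots,5$ respectively. The *derived sequence* $w'$ of an admissible word $w$ is obtained by keeping exactly the letters whose two neighbours are equal, and $w^{(k)}$ is the result of $k$ derivations. Let $\nu_i$ ($0\le i\le 5$) be the identity for $i=0$, the rotation by $-\pi/3$ for $i=2$, the rotation by $-2\pi/3$ for $i=4$, and the reflection in the line through the origin of direction $\pi/6$, $\pi/3$, $\pi/2$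 for $i=1,3,5$ respectively; $\nu_i$ carries the directions in $[\frac{i\pi}{6},\frac{(i+1)\pi}{6}]$ to those in $[0,\frac{\pi}{6}]$. Put $\gamma=\begin{pmatrix}-1&2\sqrt3\\0&1\end{pmatrix}$ and $\gamma_i=\nu_i^{-1}\gamma\nu_i$, and let $V_{\mathscr E}$ be the group generated by $\gamma_0,\dots,\gamma_5$. Identify the Teichmüller disk of $S_E$ with the upper half plane $\mathbb H$ (equivalently, the unit disk, via $z\mapsto\frac{z-i}{z+i}$) by sending the isometry class of the marked surface $g\cdot S_E$ to $g^{T}\cdot i$. Matrices act on it on the right by $z\cdot h=h^{T}z$, where matrices of negative determinant act through complex conjugation. Let $E_0$ be the geodesic with end points $0$ and $-1/\sqrt3$, and $E_i=E_0\cdot\nu_i$; these six geodesics bound an ideal hexagon. The sides of the ideal-hexagon tessellation are the geodesics $E_i\cdot g$ with $g\in V_{\mathscr E}$, and $E_i\cdot g$ is labelled $i$. Let $r_\theta$ be the geodesic ray of the surfaces $g^\theta_t\cdot S_E$, $t\ge 0$, where $$g_t^\theta=\rho_{\frac{\pi}{2}-\theta}^{-1}\begin{pmatrix}e^{t/2}&0\\0&e^{-t/2}\end{pmatrix}\rho_{\frac{\pi}{2}-\theta}$$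 and $\rho_a$ is the counter-clockwise rotation by $a$; it runs from $i$ to the boundary point $-\tan\theta$. Its *Teichmüller cutting sequence* $s_0,s_1,\dots$ is the sequence of the labels of the sides that it crosses. **Proposition.** Let $w$ be the cutting sequence of a trajectory $\tau$ in direction $\theta$ on $S_E$. If $\tau$ is not periodic, then the Teichmüller cutting sequence of $r_\theta$ is infinite. For every $k\ge 0$ such that $r_\theta$ crosses at least $k$ sides (hence for every $k$ if $\tau$ is not periodic), let $s_0,\dots,s_{k-1}$ be the labels of the first $k$ sides crossed, and put $\gamma^{(k)}=\gamma_{s_{k-1}}\cdots\gamma_{s_1}\gamma_{s_0}$. Then: 1. the $k$-th derived sequence $w^{(k)}$ is defined, that is, $w,w',\dots,w^{(k-1)}$ are admissible and $w',\dots,w^{(k)}$ are bi-infinite words; 2. there is a unique affine automorphism $\Psi=\Psi_{\gamma^{(k)}}$ of $S_E$ (a homeomorphism preserving the set of singular points, with constant derivative outside of it) with derivative $\gamma^{(k)}$; 3. $w^{(k)}$ is the cutting sequence of the same trajectory $\tau$ with respect to the sides of $\Psi_{\gamma^{(k)}}^{-1}E$, where the side $\Psi_{\gamma^{(k)}}^{-1}(L)$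 carries the label of the side $L$ of $E$. Equivalently, $w^{(k)}$ is the cutting sequence of $\Psi_{\gamma^{(k)}}\tau=\Psi_{\gamma_{s_{k-1}}}\cdots\Psi_{\gamma_{s_0}}\tau$ with respect to $E$. -/

import Mathlib

open Set Filter Topology

noncomputable section

/-! ### The hexagon surface and its linear trajectories -/

/-- The plane in which the hexagon lies. -/
abbrev Plane : Type := Fin 2 → ℝ

/-- The labels of the three pairs of opposite sides of the hexagon. -/
inductive HexLabel : Type
  | A
  | B
  | C

/-- The vertices of the regular hexagon `E` with side length one, centred at the origin, with two
horizontal sides; counter-clockwise from `(1, 0)`. -/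
def hexVertex : Fin 6 → Plane :=
  ![![1, 0], ![1 / 2, √3 / 2], ![-(1 / 2), √3 / 2], ![-1, 0], ![-(1 / 2), -(√3 / 2)],
    ![1 / 2, -(√3 / 2)]]

/-- One side of `E` from each pair of opposite sides: the top side is labelled `A`, and the labels
`B`, `C` follow clockwise. -/
def hexSegment : HexLabel → Set Plane
  | HexLabel.A => segment ℝ (hexVertex 2) (hexVertex 1)
  | HexLabel.B => segment ℝ (hexVertex 1) (hexVertex 0)
  | HexLabel.C => segment ℝ (hexVertex 0) (hexVertex 5)

/-- The translation that carries the side opposite to `hexSegment L` to `hexSegment L`. -/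
def hexGluing : HexLabel → Plane
  | HexLabel.A => hexVertex 2 - hexVertex 4
  | HexLabel.B => hexVertex 1 - hexVertex 3
  | HexLabel.C => hexVertex 0 - hexVertex 2

/-- The lattice of translations generated by the gluings of opposite sides. -/
def hexLattice : AddSubgroup Plane := AddSubgroup.closure (range hexGluing)

/-- The translation surface `S_E` obtained from `E` by gluing opposite sides by translations.
The translates of `E` by `hexLattice` tile the plane and two points of `E` are glued exactly when
they differ by an element of `hexLattice`, so that the surface is a flat torus. -/
abbrev HexSurface : Type := Plane ⧸ hexLattice

/-- The projection of the plane (in particular of `E`) to `S_E`; it is locally the inverse of a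
flat chart. -/
def toSurface (x : Plane) : HexSurface := (x : HexSurface)

/-- The (fake) singularities of `S_E`: the images of the vertices of `E`. -/
def hexSing : Set HexSurface := toSurface '' range hexVertex

/-- The sides of `E` in `S_E` (opposite sides of `E` have the same image). -/
def hexSide (L : HexLabel) : Set HexSurface := toSurface '' hexSegment L

/-- The linear trajectory in direction `θ` through the image of `p`. -/
def trajectory (θ : ℝ) (p : Plane) (t : ℝ) : HexSurface :=
  toSurface (p + t • ![Real.cos θ, Real.sin θ])

/-- A trajectory that closes up. -/
def IsPeriodicTrajectory (τ : ℝ → HexSurface) : Prop :=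
  ∃ T : ℝ, 0 < T ∧ ∀ t, τ (t + T) = τ t

/-- `w` is the cutting sequence of `τ` with respect to the labelled sides `sides`: the times at
which `τ` hits a side are listed in increasing order by `t`, and `w n` is the label of the side hit
at time `t n`. As usual, the choice of the hit with index `0` is free. -/
def IsCuttingSequence (sides : HexLabel → Set HexSurface) (τ : ℝ → HexSurface)
    (w : ℤ → HexLabel) : Prop :=
  ∃ t : ℤ → ℝ, StrictMono t ∧ range t = {u | ∃ L, τ u ∈ sides L} ∧ ∀ n, τ (t n) ∈ sides (w n)

/-! ### Affine automorphisms -/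

/-- `Ψ` is an affine automorphism of `S_E` with derivative `η`: a homeomorphism that preserves the
set of singularities and that, in the flat charts, has the constant derivative `η` outside this
set (that is, it is locally `x ↦ η x + c` there). -/
def IsAffineAutomorphism (Ψ : HexSurface ≃ₜ HexSurface) (η : Matrix (Fin 2) (Fin 2) ℝ) : Prop :=
  Ψ '' hexSing = hexSing ∧
    ∀ x : Plane, toSurface x ∉ hexSing →
      ∀ᶠ v in 𝓝 (0 : Plane),
        Ψ (toSurface (x + v)) = Ψ (toSurface x) + toSurface (Matrix.mulVec η v)

/-! ### Admissible words and derivation -/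

/-- The arrows of the diagram `x ⇄ y ⇄ z` with a loop at `z`. -/
def diagramArrow (x y z a b : HexLabel) : Prop :=
  (a = x ∧ b = y) ∨ (a = y ∧ b = x) ∨ (a = y ∧ b = z) ∨ (a = z ∧ b = y) ∨ (a = z ∧ b = z)

/-- The arrows of the six transition diagrams. -/
def transition : Fin 6 → HexLabel → HexLabel → Prop :=
  ![diagramArrow HexLabel.A HexLabel.C HexLabel.B,
    diagramArrow HexLabel.C HexLabel.A HexLabel.B,
    diagramArrow HexLabel.C HexLabel.B HexLabel.A,
    diagramArrow HexLabel.B HexLabel.C HexLabel.A,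
    diagramArrow HexLabel.B HexLabel.A HexLabel.C,
    diagramArrow HexLabel.A HexLabel.B HexLabel.C]

/-- A word is admissible if it is a bi-infinite path in one of the six diagrams. -/
def Admissible (w : ℤ → HexLabel) : Prop :=
  ∃ i : Fin 6, ∀ n, transition i (w n) (w (n + 1))

/-- `v` is the derived sequence of the admissible word `w`: it is obtained from `w` by keeping
exactly the sandwiched letters, those whose two neighbours are equal. -/
def IsDerived (w v : ℤ → HexLabel) : Prop :=
  Admissible w ∧ ∃ φ : ℤ → ℤ, StrictMono φ ∧ range φ = {n | w (n - 1) = w (n + 1)} ∧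
    ∀ n, v n = w (φ n)

/-- `v` is the `k`-th derived sequence of `w`. -/
def IsIteratedDerived : ℕ → (ℤ → HexLabel) → (ℤ → HexLabel) → Prop
  | 0, w, v => v = w
  | k + 1, w, v => ∃ u, IsIteratedDerived k w u ∧ IsDerived u v

/-! ### The elements of the Veech group -/

/-- The element `ν i` of the dihedral group that carries the sector of directions
`[i π / 6, (i + 1) π / 6]` to `[0, π / 6]`, as a matrix. -/
def nuMatrix : Fin 6 → Matrix (Fin 2) (Fin 2) ℝ :=
  ![!![1, 0; 0, 1],
    !![1 / 2, √3 / 2; √3 / 2, -(1 / 2)],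
    !![1 / 2, √3 / 2; -(√3 / 2), 1 / 2],
    !![-(1 / 2), √3 / 2; √3 / 2, 1 / 2],
    !![-(1 / 2), √3 / 2; -(√3 / 2), -(1 / 2)],
    !![-1, 0; 0, 1]]

theorem nuMatrix_det_ne_zero (i : Fin 6) : (nuMatrix i).det ≠ 0 := by
  have h : √3 * √3 = (3 : ℝ) := Real.mul_self_sqrt (by norm_num)
  fin_cases i <;> simp [nuMatrix, Matrix.det_fin_two] <;> intro h0 <;> nlinarith

def nu (i : Fin 6) : GL (Fin 2) ℝ :=
  Matrix.GeneralLinearGroup.mkOfDetNeZero (nuMatrix i) (nuMatrix_det_ne_zero i)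

/-- The orientation reversing Veech shear `γ`. -/
def veechGamma : GL (Fin 2) ℝ :=
  Matrix.GeneralLinearGroup.mkOfDetNeZero !![-1, 2 * √3; 0, 1] (by simp [Matrix.det_fin_two])

/-- `γ i = (ν i)⁻¹ γ (ν i)`. -/
def gammaConj (i : Fin 6) : GL (Fin 2) ℝ := (nu i)⁻¹ * veechGamma * nu i

/-- The subgroup of the Veech group generated by the `γ i`. -/
def hexReflectionGroup : Subgroup (GL (Fin 2) ℝ) := Subgroup.closure (range gammaConj)

/-- The product `γ (s (k - 1)) * ⋯ * γ (s 1) * γ (s 0)`. -/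
def gammaProd (s : ℕ → Fin 6) : ℕ → GL (Fin 2) ℝ
  | 0 => 1
  | k + 1 => gammaConj (s k) * gammaProd s k

/-! ### The Teichmüller disk, in its upper half plane model -/

/-- The right action of matrices on the Teichmüller disk. The disk is identified with the upper
half plane in such a way that the isometry class of the marked surface `g · S_E`, that is, the
coset `O(2) g`, is the point `gᵀ • i`; the right multiplication `O(2) g ↦ O(2) g h` then becomes
`z ↦ hᵀ • z`. Matrices with negative determinant act through complex conjugation. -/
def rightAct (z : UpperHalfPlane) (h : GL (Fin 2) ℝ) : UpperHalfPlane :=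
  Matrix.GeneralLinearGroup.mkOfDetNeZero (Matrix.transpose (h : Matrix (Fin 2) (Fin 2) ℝ))
    (by rw [Matrix.det_transpose]; exact h.det_ne_zero) • z

/-- The point of the Teichmüller disk given by the marked surface `g · S_E`. -/
def teichPoint (g : GL (Fin 2) ℝ) : UpperHalfPlane := rightAct UpperHalfPlane.I g

/-- The counter-clockwise rotation by `a`. -/
def rotationGL (a : ℝ) : GL (Fin 2) ℝ :=
  Matrix.GeneralLinearGroup.mkOfDetNeZero !![Real.cos a, -Real.sin a; Real.sin a, Real.cos a]
    (by rw [Matrix.det_fin_two_of]; nlinarith [Real.sin_sq_add_cos_sq a])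

/-- The Teichmüller flow `g_t`. -/
def teichFlow (t : ℝ) : GL (Fin 2) ℝ :=
  Matrix.GeneralLinearGroup.mkOfDetNeZero !![Real.exp (t / 2), 0; 0, Real.exp (-(t / 2))]
    (by rw [Matrix.det_fin_two_of]; simp)

/-- The conjugate of `g_t` that contracts the direction `θ` and expands the orthogonal one. -/
def teichFlowDir (θ t : ℝ) : GL (Fin 2) ℝ :=
  (rotationGL (Real.pi / 2 - θ))⁻¹ * teichFlow t * rotationGL (Real.pi / 2 - θ)

/-- The Teichmüller geodesic ray `r_θ` (used for `0 ≤ t`): it starts at `i`, the centre of the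
disk, and ends at the boundary point `-tan θ`. -/
def teichRay (θ t : ℝ) : UpperHalfPlane := teichPoint (teichFlowDir θ t)

/-- The side `E_0` of the central ideal hexagon: the geodesic with end points `0 = -tan 0` and
`-1 / √3 = -tan (π / 6)`. -/
def baseSide : Set UpperHalfPlane :=
  {z | ‖(z : ℂ) + (1 / (2 * √3) : ℝ)‖ = 1 / (2 * √3)}

/-- The side `E_i = E_0 ν_i` of the central ideal hexagon. -/
def idealSide (i : Fin 6) : Set UpperHalfPlane := (fun z => rightAct z (nu i)) '' baseSide

/-- The union of the sides labelled `i` of the ideal hexagon tessellation: the sides that an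
element of the reflection group carries to `E_i`. -/
def tessellationSides (i : Fin 6) : Set UpperHalfPlane :=
  {z | ∃ g ∈ hexReflectionGroup, z ∈ (fun y => rightAct y g) '' idealSide i}

/-- `s 0, …, s (k - 1)` are the first `k` entries of the Teichmüller cutting sequence of the ray
`r_θ`: the ray crosses at least `k` sides of the tessellation, `t 0 < ⋯ < t (k - 1)` are the times
of the first `k` crossings, and `s j` is the label of the side crossed at time `t j`. -/
def IsTeichCuttingPrefix (θ : ℝ) (s : ℕ → Fin 6) (k : ℕ) : Prop :=
  ∃ t : ℕ → ℝ, StrictMonoOn t (Iio k) ∧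
    (∀ j < k, 0 ≤ t j ∧ teichRay θ (t j) ∈ tessellationSides (s j)) ∧
    ∀ u : ℝ, 0 ≤ u → (∃ i, teichRay θ u ∈ tessellationSides i) →
      (∃ j < k, u = t j) ∨ ∀ j < k, t j < u

end

/-! Use the basis (1, 0), (3/2, √3/2), whose vectors bound the first sector of directions. In
coordinates (a, b) the gluing lattice is 3ℤ × ℤ, the singular points are the other integer points,
and γ is the reflection (a, b) ↦ (-a, b). The lines b ∈ ℤ and a ≡ ±1 mod 3 cut the plane into cells
of width 2 and 1 alternately. The sides B and C are the antidiagonals of the wide and of the narrow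
cells, and A consists of the horizontal edges of the narrow cells. The reflection γ preserves the
grid and the edges A, and exchanges antidiagonals with main diagonals.

A line of positive slope that avoids the vertices crosses the antidiagonal of every cell it visits,
and the main diagonal exactly when it enters and leaves through opposite edges. The letters before
and after an antidiagonal record the edges of entry and exit, so they agree exactly in this case; a
letter A always stands between two letters C. Keeping the sandwiched letters therefore replaces the
sides by their images under γ⁻¹ = γ (`GridLine.IsCutting.derived`). The symmetries ±ν_i reduce every
open sector to the first one (`isCuttingSequence_of_isDerived`), and the step is iterated in
`iterated_derivation`.

On the Teichmüller side, the point of g · S_E carries the Gram form ⟨g v, g v'⟩ up to scale, and E_i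
is the locus where the two vectors bounding sector i are orthogonal. Along r_θ this pairing is a
positive factor times X - e^{2t} f_i, where f_i is the value of `sectorForm i` at the direction,
positive exactly in the open sector i (`exists_rayForm`). So the ray leaves the central hexagon
through E_i exactly when θ lies in the open sector i, and reflecting in that side replaces θ by its
image under γ_i (`EntersHexagon.exists_exit`). A ping-pong argument on sectors shows that no
tessellation side enters the open hexagon. Hence the crossed labels are the sectors that govern the
successive derivations (`IsTeichCuttingPrefix.sectorForm_pos`). Sector boundaries and their images
are lattice directions, so a non-periodic direction never reaches one and the sequence does not
stop.

The automorphism Ψ is induced by a linear map preserving the lattice and the singular set; it is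
unique because no nonzero translation preserves the two singular points. -/

noncomputable section

/-! ### Lattice coordinates -/

/-- The first coordinate with respect to the basis `(1, 0)`, `(3 / 2, √3 / 2)`. -/
def coordA (x : Plane) : ℝ := x 0 - √3 * x 1

/-- The second coordinate with respect to the basis `(1, 0)`, `(3 / 2, √3 / 2)`. -/
def coordB (x : Plane) : ℝ := 2 * √3 / 3 * x 1

theorem sqrt_three_mul_self : √3 * √3 = (3 : ℝ) := Real.mul_self_sqrt (by norm_num)

@[simp] theorem coordA_zero : coordA 0 = 0 := by simp [coordA]
@[simp] theorem coordB_zero : coordB 0 = 0 := by simp [coordB]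
@[simp] theorem coordA_add (x y : Plane) : coordA (x + y) = coordA x + coordA y := by
  simp [coordA]; ring
@[simp] theorem coordB_add (x y : Plane) : coordB (x + y) = coordB x + coordB y := by
  simp [coordB]; ring
@[simp] theorem coordA_neg (x : Plane) : coordA (-x) = -coordA x := by simp [coordA]; ring
@[simp] theorem coordB_neg (x : Plane) : coordB (-x) = -coordB x := by simp [coordB]
@[simp] theorem coordA_sub (x y : Plane) : coordA (x - y) = coordA x - coordA y := by
  simp [coordA]; ring
@[simp] theorem coordB_sub (x y : Plane) : coordB (x - y) = coordB x - coordB y := by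
  simp [coordB]; ring
@[simp] theorem coordA_smul (c : ℝ) (x : Plane) : coordA (c • x) = c * coordA x := by
  simp [coordA]; ring
@[simp] theorem coordB_smul (c : ℝ) (x : Plane) : coordB (c • x) = c * coordB x := by
  simp [coordB]; ring

theorem plane_ext_coord {x y : Plane} (hA : coordA x = coordA y) (hB : coordB x = coordB y) :
    x = y := by
  have h3 : (0 : ℝ) < √3 := by positivity
  have h1 : x 1 = y 1 := by
    unfold coordB at hB
    exact mul_left_cancel₀ (by positivity) hB
  have h0 : x 0 = y 0 := by
    unfold coordA at hA
    rw [h1] at hA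
    linarith
  ext i
  fin_cases i
  · exact h0
  · exact h1

theorem continuous_coordA : Continuous coordA := by unfold coordA; fun_prop

theorem continuous_coordB : Continuous coordB := by unfold coordB; fun_prop

theorem coordA_hexVertex (i : Fin 6) :
    coordA (hexVertex i) = (![1, -1, -2, -1, 1, 2] : Fin 6 → ℝ) i := by
  have h := sqrt_three_mul_self
  fin_cases i <;> simp [coordA, hexVertex] <;> linarith

theorem coordB_hexVertex (i : Fin 6) :
    coordB (hexVertex i) = (![0, 1, 1, 0, -1, -1] : Fin 6 → ℝ) i := by
  have h := sqrt_three_mul_self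
  fin_cases i <;> simp [coordB, hexVertex] <;> linarith

theorem mem_hexLattice_iff (x : Plane) :
    x ∈ hexLattice ↔ ∃ m n : ℤ, coordA x = 3 * m ∧ coordB x = n := by
  constructor
  · intro h
    induction h using AddSubgroup.closure_induction with
    | mem x hx =>
      obtain ⟨L, rfl⟩ := hx
      cases L
      · exact ⟨-1, 2, by simp [hexGluing, coordA_hexVertex]; norm_num,
          by simp [hexGluing, coordB_hexVertex]; norm_num⟩
      · exact ⟨0, 1, by simp [hexGluing, coordA_hexVertex],
          by simp [hexGluing, coordB_hexVertex]⟩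
      · exact ⟨1, -1, by simp [hexGluing, coordA_hexVertex]; norm_num,
          by simp [hexGluing, coordB_hexVertex]⟩
    | zero => exact ⟨0, 0, by simp, by simp⟩
    | add x y _ _ hx hy =>
      obtain ⟨m, n, h1, h2⟩ := hx
      obtain ⟨m', n', h3, h4⟩ := hy
      exact ⟨m + m', n + n', by simp [h1, h3]; ring, by simp [h2, h4]⟩
    | neg x _ hx =>
      obtain ⟨m, n, h1, h2⟩ := hx
      exact ⟨-m, -n, by simp [h1], by simp [h2]⟩
  · rintro ⟨m, n, h1, h2⟩
    have hA : hexGluing HexLabel.A ∈ hexLattice :=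
      AddSubgroup.subset_closure (mem_range_self HexLabel.A)
    have hB : hexGluing HexLabel.B ∈ hexLattice :=
      AddSubgroup.subset_closure (mem_range_self HexLabel.B)
    -- The gluings A and B have lattice coordinates (-3, 2) and (0, 1), so they already generate 3ℤ
    -- × ℤ.
    have hx : x = (2 * m + n) • hexGluing HexLabel.B - m • hexGluing HexLabel.A := by
      apply plane_ext_coord
      · rw [h1, ← Int.cast_smul_eq_zsmul ℝ, ← Int.cast_smul_eq_zsmul ℝ]
        simp [hexGluing, coordA_hexVertex]; ring
      · rw [h2, ← Int.cast_smul_eq_zsmul ℝ, ← Int.cast_smul_eq_zsmul ℝ]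
        simp [hexGluing, coordB_hexVertex]; ring
    rw [hx]
    exact sub_mem (zsmul_mem hB _) (zsmul_mem hA _)

theorem toSurface_eq_iff (x y : Plane) : toSurface x = toSurface y ↔ x - y ∈ hexLattice := by
  unfold toSurface
  rw [eq_comm, QuotientAddGroup.eq, neg_add_eq_sub]

/-- The six vertices give two points of the surface: even indices have a ≡ 1 mod 3, odd indices have
a ≡ 2 mod 3. -/
theorem mem_hexSing_iff (x : Plane) :
    toSurface x ∈ hexSing ↔
      ∃ m n : ℤ, (coordA x = 3 * m + 1 ∨ coordA x = 3 * m + 2) ∧ coordB x = n := by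
  constructor
  · rintro ⟨_, ⟨i, rfl⟩, h⟩
    rw [toSurface_eq_iff, mem_hexLattice_iff] at h
    obtain ⟨m, n, h1, h2⟩ := h
    simp only [coordA_sub, coordB_sub, coordA_hexVertex, coordB_hexVertex] at h1 h2
    fin_cases i <;> simp at h1 h2
    · exact ⟨-m, -n, Or.inl (by push_cast; linarith), by push_cast; linarith⟩
    · exact ⟨-m - 1, -n + 1, Or.inr (by push_cast; linarith), by push_cast; linarith⟩
    · exact ⟨-m - 1, -n + 1, Or.inl (by push_cast; linarith), by push_cast; linarith⟩
    · exact ⟨-m - 1, -n, Or.inr (by push_cast; linarith), by push_cast; linarith⟩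
    · exact ⟨-m, -n - 1, Or.inl (by push_cast; linarith), by push_cast; linarith⟩
    · exact ⟨-m, -n - 1, Or.inr (by push_cast; linarith), by push_cast; linarith⟩
  · rintro ⟨m, n, h1 | h1, h2⟩
    · refine ⟨_, mem_range_self 0, ?_⟩
      rw [toSurface_eq_iff, mem_hexLattice_iff]
      exact ⟨-m, -n, by simp [coordA_hexVertex, h1], by simp [coordB_hexVertex, h2]⟩
    · refine ⟨_, mem_range_self 3, ?_⟩
      rw [toSurface_eq_iff, mem_hexLattice_iff]
      exact ⟨-m - 1, -n, by simp [coordA_hexVertex, h1]; ring, by simp [coordB_hexVertex, h2]⟩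

/-- The midpoint of the representative `hexSegment L`. -/
def sideMid (L : HexLabel) : Plane := (1 / 2 : ℝ) • hexGluing L

/-- Half of the edge vector of `hexSegment L`. -/
def sideHalf : HexLabel → Plane
  | HexLabel.A => (1 / 2 : ℝ) • (hexVertex 1 - hexVertex 2)
  | HexLabel.B => (1 / 2 : ℝ) • (hexVertex 0 - hexVertex 1)
  | HexLabel.C => (1 / 2 : ℝ) • (hexVertex 5 - hexVertex 0)

theorem mem_segment_iff_mid {P Q m h x : Plane} (hP : P = m - h) (hQ : Q = m + h) :
    x ∈ segment ℝ P Q ↔ ∃ s : ℝ, -1 ≤ s ∧ s ≤ 1 ∧ x = m + s • h := by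
  subst hP hQ
  rw [segment_eq_image']
  constructor
  · rintro ⟨r, ⟨h0, h1⟩, rfl⟩
    refine ⟨2 * r - 1, by linarith, by linarith, ?_⟩
    module
  · rintro ⟨s, h0, h1, rfl⟩
    refine ⟨(s + 1) / 2, ⟨by linarith, by linarith⟩, ?_⟩
    module

theorem mem_hexSegment_iff (L : HexLabel) (x : Plane) :
    x ∈ hexSegment L ↔ ∃ s : ℝ, -1 ≤ s ∧ s ≤ 1 ∧ x = sideMid L + s • sideHalf L := by
  cases L
  all_goals
    apply mem_segment_iff_mid <;> apply plane_ext_coord <;>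
      simp [sideMid, sideHalf, hexGluing, coordA_hexVertex, coordB_hexVertex] <;> norm_num

theorem mem_hexSide_iff (L : HexLabel) (x : Plane) :
    toSurface x ∈ hexSide L ↔
      ∃ s : ℝ, -1 ≤ s ∧ s ≤ 1 ∧ x - (sideMid L + s • sideHalf L) ∈ hexLattice := by
  constructor
  · rintro ⟨y, hy, h⟩
    obtain ⟨s, h0, h1, rfl⟩ := (mem_hexSegment_iff L y).1 hy
    exact ⟨s, h0, h1, (toSurface_eq_iff _ _).1 h.symm⟩
  · rintro ⟨s, h0, h1, h⟩
    exact ⟨_, (mem_hexSegment_iff L _).2 ⟨s, h0, h1, rfl⟩, ((toSurface_eq_iff _ _).2 h).symm⟩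

theorem coordA_sideMid (L : HexLabel) :
    coordA (sideMid L) = HexLabel.casesOn L (-(3 / 2)) 0 (3 / 2) := by
  cases L <;> simp [sideMid, hexGluing, coordA_hexVertex] <;> norm_num

theorem coordB_sideMid (L : HexLabel) :
    coordB (sideMid L) = HexLabel.casesOn L 1 (1 / 2) (-(1 / 2)) := by
  cases L <;> simp [sideMid, hexGluing, coordB_hexVertex] <;> norm_num

theorem coordA_sideHalf (L : HexLabel) :
    coordA (sideHalf L) = HexLabel.casesOn L (1 / 2) 1 (1 / 2) := by
  cases L <;> simp [sideHalf, coordA_hexVertex] <;> norm_num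

theorem coordB_sideHalf (L : HexLabel) :
    coordB (sideHalf L) = HexLabel.casesOn L 0 (-(1 / 2)) (-(1 / 2)) := by
  cases L <;> simp [sideHalf, coordB_hexVertex]

/-- This and the next two descriptions exhibit the sides as parts of a rectangular grid: A as edges
of the cells of width one, B and C as the antidiagonals of the cells of width two and one. -/
theorem mem_hexSide_A_iff (x : Plane) :
    toSurface x ∈ hexSide HexLabel.A ↔
      ∃ m n : ℤ, coordB x = n ∧ 3 * m + 1 ≤ coordA x ∧ coordA x ≤ 3 * m + 2 := by
  simp only [mem_hexSide_iff, mem_hexLattice_iff]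
  simp only [coordA_sub, coordB_sub, coordA_add, coordB_add, coordA_smul, coordB_smul,
    coordA_sideMid, coordB_sideMid, coordA_sideHalf, coordB_sideHalf]
  constructor
  · rintro ⟨s, h0, h1, m, n, h2, h3⟩
    exact ⟨m - 1, n + 1, by push_cast; linarith, by push_cast; linarith, by push_cast; linarith⟩
  · rintro ⟨m, n, h1, h2, h3⟩
    exact ⟨2 * (coordA x - 3 * m) - 3, by linarith, by linarith, m + 1, n - 1,
      by push_cast; linarith, by push_cast; linarith⟩

theorem mem_hexSide_B_iff (x : Plane) :
    toSurface x ∈ hexSide HexLabel.B ↔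
      ∃ m n : ℤ, n ≤ coordB x ∧ coordB x ≤ n + 1 ∧
        coordA x + 2 * (coordB x - n) = 3 * m + 1 := by
  simp only [mem_hexSide_iff, mem_hexLattice_iff]
  simp only [coordA_sub, coordB_sub, coordA_add, coordB_add, coordA_smul, coordB_smul,
    coordA_sideMid, coordB_sideMid, coordA_sideHalf, coordB_sideHalf]
  constructor
  · rintro ⟨s, h0, h1, m, n, h2, h3⟩
    exact ⟨m, n, by linarith, by linarith, by linarith⟩
  · rintro ⟨m, n, h1, h2, h3⟩
    exact ⟨1 - 2 * (coordB x - n), by linarith, by linarith, m, n, by linarith, by linarith⟩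

theorem mem_hexSide_C_iff (x : Plane) :
    toSurface x ∈ hexSide HexLabel.C ↔
      ∃ m n : ℤ, n ≤ coordB x ∧ coordB x ≤ n + 1 ∧
        coordA x + (coordB x - n) = 3 * m + 2 := by
  simp only [mem_hexSide_iff, mem_hexLattice_iff]
  simp only [coordA_sub, coordB_sub, coordA_add, coordB_add, coordA_smul, coordB_smul,
    coordA_sideMid, coordB_sideMid, coordA_sideHalf, coordB_sideHalf]
  constructor
  · rintro ⟨s, h0, h1, m, n, h2, h3⟩
    exact ⟨m, n - 1, by push_cast; linarith, by push_cast; linarith, by push_cast; linarith⟩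
  · rintro ⟨m, n, h1, h2, h3⟩
    exact ⟨1 - 2 * (coordB x - n), by linarith, by linarith, m, n + 1, by linarith,
      by push_cast; linarith⟩

/-! ### Linear symmetries of the lattice and of the singular set -/

/-- The linear action of `GL₂(ℝ)` on the plane. -/
def planeMap (g : GL (Fin 2) ℝ) (x : Plane) : Plane :=
  Matrix.mulVec (g : Matrix (Fin 2) (Fin 2) ℝ) x

@[simp] theorem planeMap_one (x : Plane) : planeMap 1 x = x := by simp [planeMap]
theorem planeMap_mul (g h : GL (Fin 2) ℝ) (x : Plane) :
    planeMap (g * h) x = planeMap g (planeMap h x) := by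
  simp only [planeMap, Units.val_mul, Matrix.mulVec_mulVec]
@[simp] theorem planeMap_inv_self (g : GL (Fin 2) ℝ) (x : Plane) :
    planeMap g⁻¹ (planeMap g x) = x := by rw [← planeMap_mul]; simp
@[simp] theorem planeMap_self_inv (g : GL (Fin 2) ℝ) (x : Plane) :
    planeMap g (planeMap g⁻¹ x) = x := by rw [← planeMap_mul]; simp
theorem planeMap_add (g : GL (Fin 2) ℝ) (x y : Plane) :
    planeMap g (x + y) = planeMap g x + planeMap g y := Matrix.mulVec_add _ _ _
theorem planeMap_sub (g : GL (Fin 2) ℝ) (x y : Plane) :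
    planeMap g (x - y) = planeMap g x - planeMap g y := Matrix.mulVec_sub _ _ _
theorem planeMap_neg (g : GL (Fin 2) ℝ) (x : Plane) : planeMap g (-x) = -planeMap g x :=
  Matrix.mulVec_neg _ _
theorem planeMap_smul (g : GL (Fin 2) ℝ) (c : ℝ) (x : Plane) :
    planeMap g (c • x) = c • planeMap g x := Matrix.mulVec_smul _ _ _
@[simp] theorem planeMap_zero (g : GL (Fin 2) ℝ) : planeMap g 0 = 0 := Matrix.mulVec_zero _

/-- The linear maps of determinant `±1` that preserve the lattice of `S_E` and its singularities. -/
def hexStabilizer : Subgroup (GL (Fin 2) ℝ) where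
  carrier := {g | (∀ x, planeMap g x ∈ hexLattice ↔ x ∈ hexLattice) ∧
    (∀ x, toSurface (planeMap g x) ∈ hexSing ↔ toSurface x ∈ hexSing) ∧
    (g : Matrix (Fin 2) (Fin 2) ℝ).det ^ 2 = 1}
  mul_mem' := by
    rintro g h ⟨h1, h2, h3⟩ ⟨h4, h5, h6⟩
    refine ⟨fun x => ?_, fun x => ?_, ?_⟩
    · rw [planeMap_mul, h1, h4]
    · rw [planeMap_mul, h2, h5]
    · rw [Units.val_mul, Matrix.det_mul, mul_pow, h3, h6, one_mul]
  one_mem' := by simp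
  inv_mem' := by
    rintro g ⟨h1, h2, h3⟩
    refine ⟨fun x => ?_, fun x => ?_, ?_⟩
    · rw [← h1, planeMap_self_inv]
    · rw [← h2, planeMap_self_inv]
    · have h := congrArg Matrix.det (Units.mul_inv g)
      rw [Matrix.det_mul, Matrix.det_one] at h
      have h' := congrArg (· ^ 2) h
      simp only [mul_pow, h3, one_mul, one_pow] at h'
      exact h'

/-- An integer matrix whose upper right entry is divisible by 3 maps both ℤ² and 3ℤ × ℤ into
themselves. With determinant d = ±1 its inverse is d times the adjugate and has the same shape. The
singular points are the integer points outside the lattice. -/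
theorem mem_hexStabilizer_of_coord {g : GL (Fin 2) ℝ} (p q r s : ℤ)
    (hA : ∀ x, coordA (planeMap g x) = p * coordA x + 3 * q * coordB x)
    (hB : ∀ x, coordB (planeMap g x) = r * coordA x + s * coordB x)
    (hdet : (p * s - 3 * q * r) ^ 2 = 1)
    (hdet' : (g : Matrix (Fin 2) (Fin 2) ℝ).det ^ 2 = 1) : g ∈ hexStabilizer := by
  set d : ℤ := p * s - 3 * q * r with hd
  have hd1 : (d : ℝ) * (p * s - 3 * q * r) = 1 := by
    have h : (d * (p * s - 3 * q * r) : ℤ) = 1 := by rw [← hd, ← sq, hdet]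
    exact_mod_cast h
  have iA : ∀ x, coordA x = d * (s * coordA (planeMap g x) - 3 * q * coordB (planeMap g x)) := by
    intro x
    rw [hA, hB]
    linear_combination (-coordA x) * hd1
  have iB : ∀ x, coordB x = d * (p * coordB (planeMap g x) - r * coordA (planeMap g x)) := by
    intro x
    rw [hA, hB]
    linear_combination (-coordB x) * hd1
  have hlat : ∀ x, planeMap g x ∈ hexLattice ↔ x ∈ hexLattice := by
    intro x
    rw [mem_hexLattice_iff, mem_hexLattice_iff]
    constructor
    · rintro ⟨m, n, h1, h2⟩
      refine ⟨d * (s * m - q * n), d * (p * n - 3 * r * m), ?_, ?_⟩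
      · rw [iA, h1, h2]; push_cast; ring
      · rw [iB, h1, h2]; push_cast; ring
    · rintro ⟨m, n, h1, h2⟩
      refine ⟨p * m + q * n, 3 * r * m + s * n, ?_, ?_⟩
      · rw [hA, h1, h2]; push_cast; ring
      · rw [hB, h1, h2]; push_cast; ring
  refine ⟨hlat, ?_, hdet'⟩
  have key : ∀ x, toSurface x ∈ hexSing ↔
      (∃ m n : ℤ, coordA x = m ∧ coordB x = n) ∧ x ∉ hexLattice := by
    intro x
    rw [mem_hexSing_iff, mem_hexLattice_iff]
    constructor
    · rintro ⟨m, n, h1 | h1, h2⟩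
      · refine ⟨⟨3 * m + 1, n, by push_cast; exact h1, h2⟩, ?_⟩
        rintro ⟨m', n', h3, -⟩
        rw [h1] at h3
        have : (3 * m + 1 : ℤ) = 3 * m' := by exact_mod_cast h3
        omega
      · refine ⟨⟨3 * m + 2, n, by push_cast; exact h1, h2⟩, ?_⟩
        rintro ⟨m', n', h3, -⟩
        rw [h1] at h3
        have : (3 * m + 2 : ℤ) = 3 * m' := by exact_mod_cast h3
        omega
    · rintro ⟨⟨m, n, h1, h2⟩, h3⟩
      have h4 : m % 3 ≠ 0 := by
        intro h
        exact h3 ⟨m / 3, n, by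
          rw [h1]; have : m = 3 * (m / 3) := by omega
          exact_mod_cast this, h2⟩
      refine ⟨m / 3, n, ?_, h2⟩
      have : m = 3 * (m / 3) + 1 ∨ m = 3 * (m / 3) + 2 := by omega
      rw [h1]
      rcases this with h | h
      · left; exact_mod_cast h
      · right; exact_mod_cast h
  intro x
  rw [key, key, hlat]
  refine and_congr_left fun _ => ?_
  constructor
  · rintro ⟨m, n, h1, h2⟩
    refine ⟨d * (s * m - 3 * q * n), d * (p * n - r * m), ?_, ?_⟩
    · rw [iA, h1, h2]; push_cast; ring
    · rw [iB, h1, h2]; push_cast; ring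
  · rintro ⟨m, n, h1, h2⟩
    refine ⟨p * m + 3 * q * n, r * m + s * n, ?_, ?_⟩
    · rw [hA, h1, h2]; push_cast; ring
    · rw [hB, h1, h2]; push_cast; ring

/-- The coefficients of `nuMatrix i` in lattice coordinates. -/
def nuCoeff : Fin 6 → ℤ × ℤ × ℤ × ℤ :=
  ![(1, 0, 0, 1), (-1, 0, 1, 1), (2, 1, -1, -1), (-2, -1, 1, 2), (1, 1, -1, -2), (-1, -1, 0, 1)]

theorem planeMap_nu (i : Fin 6) (x : Plane) : planeMap (nu i) x = (nuMatrix i).mulVec x := rfl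

theorem coordA_nu (i : Fin 6) (x : Plane) : coordA (planeMap (nu i) x) =
    (nuCoeff i).1 * coordA x + 3 * (nuCoeff i).2.1 * coordB x := by
  have h := sqrt_three_mul_self
  rw [planeMap_nu]
  fin_cases i <;>
    simp [coordA, coordB, nuMatrix, nuCoeff, Matrix.mulVec, dotProduct, Fin.sum_univ_two] <;>
    grind

theorem coordB_nu (i : Fin 6) (x : Plane) : coordB (planeMap (nu i) x) =
    (nuCoeff i).2.2.1 * coordA x + (nuCoeff i).2.2.2 * coordB x := by
  have h := sqrt_three_mul_self
  rw [planeMap_nu]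
  fin_cases i <;>
    simp [coordA, coordB, nuMatrix, nuCoeff, Matrix.mulVec, dotProduct, Fin.sum_univ_two] <;>
    grind

theorem nu_mem_hexStabilizer (i : Fin 6) : nu i ∈ hexStabilizer := by
  have h := sqrt_three_mul_self
  refine mem_hexStabilizer_of_coord _ _ _ _ (coordA_nu i) (coordB_nu i) ?_ ?_
  · revert i; decide
  · change (nuMatrix i).det ^ 2 = 1
    fin_cases i <;> simp [nuMatrix, Matrix.det_fin_two] <;> grind

/-- The coordinates are adapted to γ: it becomes a reflection that preserves the grid and swaps the
two kinds of diagonals. -/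
theorem coordA_veechGamma (x : Plane) : coordA (planeMap veechGamma x) = -coordA x := by
  change coordA (Matrix.mulVec !![-1, 2 * √3; 0, 1] x) = _
  simp [coordA, Matrix.mulVec, dotProduct, Fin.sum_univ_two]
  ring

theorem coordB_veechGamma (x : Plane) : coordB (planeMap veechGamma x) = coordB x := by
  change coordB (Matrix.mulVec !![-1, 2 * √3; 0, 1] x) = _
  simp [coordB, Matrix.mulVec, dotProduct, Fin.sum_univ_two]

theorem veechGamma_mem_hexStabilizer : veechGamma ∈ hexStabilizer := by
  refine mem_hexStabilizer_of_coord (-1) 0 0 1 ?_ ?_ (by norm_num) ?_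
  · intro x; rw [coordA_veechGamma]; push_cast; ring
  · intro x; rw [coordB_veechGamma]; push_cast; ring
  · change (Matrix.det !![-1, 2 * √3; 0, 1]) ^ 2 = 1
    simp [Matrix.det_fin_two]

theorem gammaConj_mem_hexStabilizer (i : Fin 6) : gammaConj i ∈ hexStabilizer :=
  mul_mem (mul_mem (inv_mem (nu_mem_hexStabilizer i)) veechGamma_mem_hexStabilizer)
    (nu_mem_hexStabilizer i)

theorem gammaProd_mem_hexStabilizer (s : ℕ → Fin 6) (k : ℕ) : gammaProd s k ∈ hexStabilizer := by
  induction k with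
  | zero => exact one_mem _
  | succ k ih => exact mul_mem (gammaConj_mem_hexStabilizer _) ih

theorem gammaProd_mem_hexReflectionGroup (s : ℕ → Fin 6) (k : ℕ) :
    gammaProd s k ∈ hexReflectionGroup := by
  induction k with
  | zero => exact one_mem _
  | succ k ih => exact mul_mem (Subgroup.subset_closure (mem_range_self _)) ih

theorem nu_gammaConj (i : Fin 6) (x : Plane) :
    planeMap (nu i) (planeMap (gammaConj i) x) = planeMap veechGamma (planeMap (nu i) x) := by
  rw [← planeMap_mul, ← planeMap_mul]
  congr 1
  simp [gammaConj, mul_assoc]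

theorem gammaConj_mul_self (i : Fin 6) : gammaConj i * gammaConj i = 1 := by
  have h : veechGamma * veechGamma = 1 := by
    apply Units.ext
    change !![-1, 2 * √3; 0, 1] * !![-1, 2 * √3; 0, 1] = (1 : Matrix (Fin 2) (Fin 2) ℝ)
    rw [Matrix.mul_fin_two, Matrix.one_fin_two]
    simp
  calc gammaConj i * gammaConj i = (nu i)⁻¹ * (veechGamma * veechGamma) * nu i := by
        unfold gammaConj; group
    _ = 1 := by rw [h]; group

/-! ### Sectors -/

/-- Positive exactly when `x` lies, up to sign, in the open `i`-th sector of directions. -/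
def sectorForm (i : Fin 6) (x : Plane) : ℝ :=
  coordA (planeMap (nu i) x) * coordB (planeMap (nu i) x)

theorem sectorForm_gammaConj (i : Fin 6) (x : Plane) :
    sectorForm i (planeMap (gammaConj i) x) = -sectorForm i x := by
  unfold sectorForm
  rw [nu_gammaConj, coordA_veechGamma, coordB_veechGamma]
  ring

/-- For two distinct indices, some positive combination of the two forms is minus a sum of squares
of the linear forms that bound the sectors; hence the forms cannot both be positive. -/
theorem sectorForm_nonpos {i j : Fin 6} (hij : i ≠ j) {x : Plane} (h : 0 ≤ sectorForm i x) :
    sectorForm j x ≤ 0 := by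
  unfold sectorForm at *
  rw [coordA_nu, coordB_nu] at *
  generalize coordA x = a at *
  generalize coordB x = b at *
  have h1 := sq_nonneg a
  have h2 := sq_nonneg b
  have h3 := sq_nonneg (a + b)
  have h4 := sq_nonneg (2 * a + 3 * b)
  have h5 := sq_nonneg (a + 2 * b)
  have h6 := sq_nonneg (a + 3 * b)
  fin_cases i <;> fin_cases j <;> first | exact absurd rfl hij | skip
  all_goals
    simp [nuCoeff] at h ⊢
    linarith

theorem sectorForm_neg {i j : Fin 6} (hij : i ≠ j) {x : Plane} (h : 0 < sectorForm i x) :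
    sectorForm j x < 0 := by
  unfold sectorForm at *
  rw [coordA_nu, coordB_nu] at *
  generalize coordA x = a at *
  generalize coordB x = b at *
  have h1 := sq_nonneg a
  have h2 := sq_nonneg b
  have h3 := sq_nonneg (a + b)
  have h4 := sq_nonneg (2 * a + 3 * b)
  have h5 := sq_nonneg (a + 2 * b)
  have h6 := sq_nonneg (a + 3 * b)
  fin_cases i <;> fin_cases j <;> first | exact absurd rfl hij | skip
  all_goals
    simp [nuCoeff] at h ⊢
    linarith

/-- Neighbouring sectors share a boundary line, so each bounding linear form occurs twice in the
product of the six forms. That product is minus a square, whereas six negative factors would make it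
positive. -/
theorem exists_sectorForm_nonneg (x : Plane) : ∃ i, 0 ≤ sectorForm i x := by
  by_contra! hcon
  have h := fun i => hcon i
  unfold sectorForm at h
  simp only [coordA_nu, coordB_nu] at h
  generalize coordA x = a at *
  generalize coordB x = b at *
  have hp : ∀ {u v w x y z : ℝ}, u < 0 → v < 0 → w < 0 → x < 0 → y < 0 → z < 0 →
      0 < (u * v) * (w * x) * (y * z) := fun hu hv hw hx hy hz =>
    mul_pos (mul_pos (mul_pos_of_neg_of_neg hu hv) (mul_pos_of_neg_of_neg hw hx))
      (mul_pos_of_neg_of_neg hy hz)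
  have hp := hp (h 0) (h 1) (h 2) (h 3) (h 4) (h 5)
  simp only [nuCoeff] at hp
  simp at hp
  nlinarith [sq_nonneg (a * b * (a + b) * (2 * a + 3 * b) * (a + 2 * b) * (a + 3 * b))]

/-! ### Lines in a grid of rectangles -/

/-- A line of positive slope in a grid formed by the vertical lines `x = X j` and the horizontal
lines `y = n`, that does not meet the vertices of the grid. -/
structure GridLine where
  X : ℤ → ℝ
  strictMono_X : StrictMono X
  a₀ : ℝ
  α : ℝ
  b₀ : ℝ
  β : ℝ
  α_pos : 0 < α
  β_pos : 0 < β
  generic : ∀ (t : ℝ) (j n : ℤ), a₀ + α * t = X j → b₀ + β * t ≠ n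

namespace GridLine

variable (G : GridLine)

/-- The horizontal coordinate along the line. -/
def a (t : ℝ) : ℝ := G.a₀ + G.α * t

/-- The vertical coordinate along the line. -/
def b (t : ℝ) : ℝ := G.b₀ + G.β * t

/-- The line is in the open cell in column `j` and row `n`. -/
def InCell (j n : ℤ) (t : ℝ) : Prop :=
  G.X j < G.a t ∧ G.a t < G.X (j + 1) ∧ n < G.b t ∧ G.b t < n + 1

/-- The line is on the open left edge of a cell. -/
def OnVert (j n : ℤ) (t : ℝ) : Prop := G.a t = G.X j ∧ n < G.b t ∧ G.b t < n + 1

/-- The line is on the open lower edge of a cell. -/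
def OnHor (j n : ℤ) (t : ℝ) : Prop := G.X j < G.a t ∧ G.a t < G.X (j + 1) ∧ G.b t = n

/-- An equation of the antidiagonal of a cell. -/
def anti (j n : ℤ) (t : ℝ) : ℝ :=
  (G.a t - G.X j) + (G.X (j + 1) - G.X j) * (G.b t - n) - (G.X (j + 1) - G.X j)

/-- An equation of the main diagonal of a cell. -/
def diag (j n : ℤ) (t : ℝ) : ℝ :=
  (G.a t - G.X j) - (G.X (j + 1) - G.X j) * (G.b t - n)

/-- The label of the diagonals of the cells in column `j`. -/
def cellLabel (j : ℤ) : HexLabel := if Even j then HexLabel.B else HexLabel.C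

/-- The label of the next diagonal or edge met when leaving a cell of column `j` through the top. -/
def topLabel (j : ℤ) : HexLabel := if Even j then HexLabel.B else HexLabel.A

/-- The line hits an antidiagonal, or a horizontal edge of an odd column, with label `L`. -/
def Hit (L : HexLabel) (t : ℝ) : Prop :=
  (L = HexLabel.A ∧ ∃ j n, Odd j ∧ G.OnHor j n t) ∨
    ∃ j n, cellLabel j = L ∧ G.InCell j n t ∧ G.anti j n t = 0

/-- The line hits a main diagonal, or a horizontal edge of an odd column, with label `L`. -/
def DiagHit (L : HexLabel) (t : ℝ) : Prop :=
  (L = HexLabel.A ∧ ∃ j n, Odd j ∧ G.OnHor j n t) ∨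
    ∃ j n, cellLabel j = L ∧ G.InCell j n t ∧ G.diag j n t = 0

theorem cellLabel_ne_A (j : ℤ) : cellLabel j ≠ HexLabel.A := by
  unfold cellLabel; split_ifs <;> simp

/-- These are the two possible neighbours of a letter read in column `j`; because they differ, a
neighbouring letter determines the edge that was used. -/
theorem cellLabel_succ_ne_topLabel (j : ℤ) : cellLabel (j + 1) ≠ topLabel j := by
  unfold cellLabel topLabel
  have h' : Even (j + 1) ↔ ¬ Even j := Int.even_add_one
  by_cases h : Even j
  · rw [if_neg (by tauto), if_pos h]; simp
  · rw [if_pos (by tauto), if_neg h]; simp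

theorem cellLabel_sub_one (j : ℤ) : cellLabel (j - 1) = cellLabel (j + 1) := by
  have h : Even (j - 1) ↔ Even (j + 1) := by simp [parity_simps]
  unfold cellLabel
  simp only [h]

variable {G}

theorem a_lt_iff {s t : ℝ} : G.a s < G.a t ↔ s < t := by
  unfold a; rw [add_lt_add_iff_left, mul_lt_mul_iff_right₀ G.α_pos]

theorem b_lt_iff {s t : ℝ} : G.b s < G.b t ↔ s < t := by
  unfold b; rw [add_lt_add_iff_left, mul_lt_mul_iff_right₀ G.β_pos]

theorem a_le_iff {s t : ℝ} : G.a s ≤ G.a t ↔ s ≤ t := by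
  rw [← not_lt, a_lt_iff, not_lt]

theorem b_le_iff {s t : ℝ} : G.b s ≤ G.b t ↔ s ≤ t := by
  rw [← not_lt, b_lt_iff, not_lt]

theorem col_unique {x : ℝ} {i j : ℤ} (h1 : G.X i ≤ x) (h2 : x < G.X (i + 1)) (h3 : G.X j ≤ x)
    (h4 : x < G.X (j + 1)) : i = j := by
  have h5 := G.strictMono_X.lt_iff_lt.1 (h1.trans_lt h4)
  have h6 := G.strictMono_X.lt_iff_lt.1 (h3.trans_lt h2)
  omega

theorem row_unique {x : ℝ} {m n : ℤ} (h1 : m ≤ x) (h2 : x < m + 1) (h3 : n ≤ x)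
    (h4 : x < n + 1) : m = n := by
  rw [← Int.floor_eq_iff.2 ⟨h1, h2⟩, Int.floor_eq_iff.2 ⟨h3, h4⟩]

theorem InCell.unique {i j m n : ℤ} {t : ℝ} (h : G.InCell i m t) (h' : G.InCell j n t) :
    i = j ∧ m = n :=
  ⟨col_unique h.1.le h.2.1 h'.1.le h'.2.1,
    row_unique h.2.2.1.le h.2.2.2 h'.2.2.1.le h'.2.2.2⟩

theorem InCell.mono {j n : ℤ} {r s t : ℝ} (hr : G.InCell j n r) (ht : G.InCell j n t)
    (hrs : r ≤ s) (hst : s ≤ t) : G.InCell j n s :=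
  ⟨hr.1.trans_le (a_le_iff.2 hrs), (a_le_iff.2 hst).trans_lt ht.2.1,
    hr.2.2.1.trans_le (b_le_iff.2 hrs), (b_le_iff.2 hst).trans_lt ht.2.2.2⟩

theorem InCell.not_onHor {i j m n : ℤ} {t : ℝ} (h : G.InCell i m t) : ¬ G.OnHor j n t := by
  rintro ⟨-, -, h3⟩
  have := row_unique h.2.2.1.le h.2.2.2 h3.ge (by rw [h3]; linarith)
  subst this
  exact h.2.2.1.ne h3.symm

theorem OnVert.not_inCell {i j m n : ℤ} {t : ℝ} (h : G.OnVert j n t) : ¬ G.InCell i m t := by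
  intro h'
  have := col_unique h'.1.le h'.2.1 h.1.ge (by rw [h.1]; exact G.strictMono_X (lt_add_one j))
  subst this
  exact h'.1.ne h.1.symm

theorem OnVert.not_onHor {i j m n : ℤ} {t : ℝ} (h : G.OnVert j n t) : ¬ G.OnHor i m t := by
  intro h'
  exact G.generic t j m h.1 h'.2.2

theorem OnHor.unique_col {i j m n : ℤ} {t : ℝ} (h : G.OnHor i m t) (h' : G.OnHor j n t) : i = j :=
  col_unique h.1.le h.2.1 h'.1.le h'.2.1

theorem Hit.of_inCell {j n : ℤ} {t : ℝ} {L : HexLabel} (h : G.Hit L t) (hc : G.InCell j n t) :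
    L = cellLabel j ∧ G.anti j n t = 0 := by
  rcases h with ⟨-, i, m, -, h⟩ | ⟨i, m, hL, hc', h⟩
  · exact absurd h hc.not_onHor
  · obtain ⟨rfl, rfl⟩ := hc.unique hc'
    exact ⟨hL.symm, h⟩

theorem DiagHit.of_inCell {j n : ℤ} {t : ℝ} {L : HexLabel} (h : G.DiagHit L t)
    (hc : G.InCell j n t) : L = cellLabel j ∧ G.diag j n t = 0 := by
  rcases h with ⟨-, i, m, -, h⟩ | ⟨i, m, hL, hc', h⟩
  · exact absurd h hc.not_onHor
  · obtain ⟨rfl, rfl⟩ := hc.unique hc'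
    exact ⟨hL.symm, h⟩

theorem OnVert.not_hit {j n : ℤ} {t : ℝ} {L : HexLabel} (hv : G.OnVert j n t) : ¬ G.Hit L t := by
  rintro (⟨-, i, m, -, h⟩ | ⟨i, m, -, h, -⟩)
  · exact hv.not_onHor h
  · exact hv.not_inCell h

theorem Hit.of_onHor {j n : ℤ} {t : ℝ} {L : HexLabel} (h : G.Hit L t) (hh : G.OnHor j n t) :
    L = HexLabel.A ∧ Odd j := by
  rcases h with ⟨hL, i, m, ho, h⟩ | ⟨i, m, -, h, -⟩
  · rw [hh.unique_col h]
    exact ⟨hL, ho⟩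
  · exact absurd hh h.not_onHor

theorem anti_sub (j n : ℤ) (s t : ℝ) : G.anti j n t - G.anti j n s =
    (G.α + (G.X (j + 1) - G.X j) * G.β) * (t - s) := by
  unfold anti a b; ring

theorem anti_slope_pos (j : ℤ) : 0 < G.α + (G.X (j + 1) - G.X j) * G.β :=
  add_pos G.α_pos (mul_pos (sub_pos.2 (G.strictMono_X (lt_add_one j))) G.β_pos)

theorem anti_lt_iff {j n : ℤ} {s t : ℝ} : G.anti j n s < G.anti j n t ↔ s < t := by
  rw [← sub_pos, anti_sub, mul_pos_iff_of_pos_left (anti_slope_pos j), sub_pos]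

theorem exists_anti_eq_zero (j n : ℤ) : ∃ t, G.anti j n t = 0 := by
  refine ⟨-G.anti j n 0 / (G.α + (G.X (j + 1) - G.X j) * G.β), ?_⟩
  have h := anti_sub (G := G) j n 0 (-G.anti j n 0 / (G.α + (G.X (j + 1) - G.X j) * G.β))
  have h' := (anti_slope_pos (G := G) j).ne'
  rw [sub_zero, mul_div_cancel₀ _ h'] at h
  linarith

theorem diag_sub (j n : ℤ) (s t : ℝ) : G.diag j n t - G.diag j n s =
    (G.α - (G.X (j + 1) - G.X j) * G.β) * (t - s) := by
  unfold diag a b; ring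

/-- Unlike the antidiagonal, the main diagonal may be parallel to the line. Two zeros would force
this, and then the line would contain the lower left corner of the cell, which genericity forbids.
-/
theorem diag_unique {j n : ℤ} {s t : ℝ} (hs : G.diag j n s = 0) (ht : G.diag j n t = 0) :
    s = t := by
  by_contra hne
  have h := diag_sub (G := G) j n s t
  rw [hs, ht, sub_zero, eq_comm, mul_eq_zero, or_iff_left (sub_ne_zero.2 (Ne.symm hne))] at h
  have hw := sub_pos.2 (G.strictMono_X (lt_add_one j))
  -- Evaluate at the time when the line meets the left side of the column.
  have hu := diag_sub (G := G) j n s ((G.X j - G.a₀) / G.α)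
  rw [h, zero_mul, hs, sub_zero] at hu
  have ha : G.a ((G.X j - G.a₀) / G.α) = G.X j := by
    unfold a; rw [mul_div_cancel₀ _ G.α_pos.ne']; ring
  unfold diag at hu
  rw [ha, sub_self, zero_sub, neg_eq_zero, mul_eq_zero, or_iff_right hw.ne', sub_eq_zero] at hu
  exact G.generic _ _ _ ha hu

/-! ### Passage of the line through one cell -/

theorem exists_exit {j n : ℤ} {t : ℝ} (h : G.InCell j n t) :
    ∃ e, t < e ∧ (∀ s, t ≤ s → s < e → G.InCell j n s) ∧
      (G.OnVert (j + 1) n e ∨ G.OnHor j (n + 1) e) := by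
  obtain ⟨u, hu⟩ : ∃ u, G.a u = G.X (j + 1) := ⟨(G.X (j + 1) - G.a₀) / G.α, by
    unfold a; rw [mul_div_cancel₀ _ G.α_pos.ne']; ring⟩
  obtain ⟨v, hv⟩ : ∃ v, G.b v = n + 1 := ⟨(n + 1 - G.b₀) / G.β, by
    unfold b; rw [mul_div_cancel₀ _ G.β_pos.ne']; ring⟩
  obtain ⟨h1, h2, h3, h4⟩ := h
  have htu : t < u := by rw [← a_lt_iff (G := G), hu]; exact h2
  have htv : t < v := by rw [← b_lt_iff (G := G), hv]; exact h4
  have hin : ∀ s, t ≤ s → s < u → s < v → G.InCell j n s := fun s hs hsu hsv =>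
    ⟨h1.trans_le (a_le_iff.2 hs), hu ▸ a_lt_iff.2 hsu, h3.trans_le (b_le_iff.2 hs),
      hv ▸ b_lt_iff.2 hsv⟩
  rcases lt_trichotomy u v with huv | rfl | huv
  · exact ⟨u, htu, fun s hs hsu => hin s hs hsu (hsu.trans huv),
      Or.inl ⟨hu, h3.trans (b_lt_iff.2 htu), hv ▸ b_lt_iff.2 huv⟩⟩
  · exact absurd (show G.b u = ((n + 1 : ℤ) : ℝ) by rw [hv]; push_cast; rfl) (G.generic u _ _ hu)
  · exact ⟨v, htv, fun s hs hsv => hin s hs (hsv.trans huv) hsv,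
      Or.inr ⟨h1.trans (a_lt_iff.2 htv), hu ▸ a_lt_iff.2 huv, by rw [hv]; push_cast; rfl⟩⟩

theorem exists_entry {j n : ℤ} {t : ℝ} (h : G.InCell j n t) :
    ∃ e, e < t ∧ (∀ s, e < s → s ≤ t → G.InCell j n s) ∧ (G.OnVert j n e ∨ G.OnHor j n e) := by
  obtain ⟨u, hu⟩ : ∃ u, G.a u = G.X j := ⟨(G.X j - G.a₀) / G.α, by
    unfold a; rw [mul_div_cancel₀ _ G.α_pos.ne']; ring⟩
  obtain ⟨v, hv⟩ : ∃ v, G.b v = n := ⟨(n - G.b₀) / G.β, by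
    unfold b; rw [mul_div_cancel₀ _ G.β_pos.ne']; ring⟩
  obtain ⟨h1, h2, h3, h4⟩ := h
  have htu : u < t := by rw [← a_lt_iff (G := G), hu]; exact h1
  have htv : v < t := by rw [← b_lt_iff (G := G), hv]; exact h3
  have hin : ∀ s, u < s → v < s → s ≤ t → G.InCell j n s := fun s hsu hsv hs =>
    ⟨hu ▸ a_lt_iff.2 hsu, (a_le_iff.2 hs).trans_lt h2, hv ▸ b_lt_iff.2 hsv,
      (b_le_iff.2 hs).trans_lt h4⟩
  rcases lt_trichotomy u v with huv | rfl | huv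
  · exact ⟨v, htv, fun s hsv hs => hin s (huv.trans hsv) hsv hs,
      Or.inr ⟨hu ▸ a_lt_iff.2 huv, (a_lt_iff.2 htv).trans h2, hv⟩⟩
  · exact absurd hv (G.generic u _ _ hu)
  · exact ⟨u, htu, fun s hsu hs => hin s hsu (huv.trans hsu) hs,
      Or.inl ⟨hu, hv ▸ b_lt_iff.2 huv, (b_lt_iff.2 htu).trans h4⟩⟩

/-- The equation `anti` increases along the line and is negative on the left and lower edges. Its
zero comes before the exit because `anti` is positive once the line has passed the right or the
upper edge. -/
theorem exists_anti_of_entry {j n : ℤ} {e : ℝ} (h : G.OnVert j n e ∨ G.OnHor j n e) :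
    ∃ t, e < t ∧ G.anti j n t = 0 ∧ ∀ s, e < s → s ≤ t → G.InCell j n s := by
  have hw := sub_pos.2 (G.strictMono_X (lt_add_one j))
  have hX := G.strictMono_X (lt_add_one j)
  obtain ⟨t, ht⟩ := exists_anti_eq_zero (G := G) j n
  have h' : G.X j ≤ G.a e ∧ n ≤ G.b e ∧ G.anti j n e < 0 := by
    rcases h with ⟨h1, h2, h3⟩ | ⟨h1, h2, h3⟩
    · refine ⟨h1.ge, h2.le, ?_⟩
      unfold anti; rw [h1]; nlinarith
    · refine ⟨h1.le, h3.ge, ?_⟩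
      unfold anti; rw [h3]; linarith
  obtain ⟨h1, h2, h3⟩ := h'
  have het : e < t := by rw [← anti_lt_iff (G := G) (j := j) (n := n), ht]; exact h3
  refine ⟨t, het, ht, fun s hs hst => ?_⟩
  have h4 := h1.trans_lt (a_lt_iff.2 hs)
  have h5 := h2.trans_lt (b_lt_iff.2 hs)
  have h6 := a_le_iff (G := G).2 hst
  have h7 := b_le_iff (G := G).2 hst
  unfold anti at ht
  refine ⟨h4, ?_, h5, ?_⟩
  · nlinarith [mul_pos hw (sub_pos.2 (h5.trans_le h7))]
  · by_contra! hcon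
    nlinarith [mul_le_mul_of_nonneg_left (hcon.trans h7) hw.le]

theorem exists_anti_of_exit {j n : ℤ} {e : ℝ} (h : G.OnVert (j + 1) n e ∨ G.OnHor j (n + 1) e) :
    ∃ t, t < e ∧ G.anti j n t = 0 ∧ ∀ s, t ≤ s → s < e → G.InCell j n s := by
  have hw := sub_pos.2 (G.strictMono_X (lt_add_one j))
  have hX := G.strictMono_X (lt_add_one j)
  obtain ⟨t, ht⟩ := exists_anti_eq_zero (G := G) j n
  have h' : G.a e ≤ G.X (j + 1) ∧ G.b e ≤ n + 1 ∧ 0 < G.anti j n e := by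
    rcases h with ⟨h1, h2, h3⟩ | ⟨h1, h2, h3⟩
    · refine ⟨h1.le, h3.le, ?_⟩
      unfold anti; rw [h1]; nlinarith
    · push_cast at h3
      refine ⟨h2.le, h3.le, ?_⟩
      unfold anti; rw [h3]; linarith
  obtain ⟨h1, h2, h3⟩ := h'
  have het : t < e := by rw [← anti_lt_iff (G := G) (j := j) (n := n), ht]; exact h3
  refine ⟨t, het, ht, fun s hst hs => ?_⟩
  have h4 := (a_lt_iff.2 hs).trans_le h1
  have h5 := (b_lt_iff.2 hs).trans_le h2
  have h6 := a_le_iff (G := G).2 hst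
  have h7 := b_le_iff (G := G).2 hst
  unfold anti at ht
  refine ⟨?_, h4, ?_, h5⟩
  · nlinarith [mul_pos hw (sub_pos.2 (h7.trans_lt h5))]
  · by_contra! hcon
    nlinarith [mul_le_mul_of_nonneg_left (h7.trans hcon) hw.le]

theorem not_hit_after {j n : ℤ} {t s : ℝ} {L : HexLabel} (ht : G.anti j n t = 0) (hts : t ≠ s)
    (hs : G.InCell j n s) : ¬ G.Hit L s := by
  intro h
  have h1 := (h.of_inCell hs).2
  rcases lt_or_gt_of_ne hts with h' | h' <;>
    · have := anti_lt_iff (G := G) (j := j) (n := n).2 h'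
      linarith

open Classical in
-- Leaving to the right leads to the antidiagonal of column `j + 1`. Leaving upwards leads to the
-- next antidiagonal of the same column if the column is wide, while in a narrow column the edge
-- just reached is itself a side A.
theorem hit_after_exit {j n : ℤ} {e : ℝ} (h : G.OnVert (j + 1) n e ∨ G.OnHor j (n + 1) e) :
    ∃ t, e ≤ t ∧ G.Hit (if G.OnHor j (n + 1) e then topLabel j else cellLabel (j + 1)) t ∧
      ∀ s, e ≤ s → s < t → ∀ L, ¬ G.Hit L s := by
  rcases h with h | h
  · rw [if_neg h.not_onHor]
    obtain ⟨t, het, ht, hin⟩ := exists_anti_of_entry (Or.inl h)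
    refine ⟨t, het.le, Or.inr ⟨j + 1, n, rfl, hin t het le_rfl, ht⟩, fun s hes hst L => ?_⟩
    rcases hes.eq_or_lt with rfl | hes
    · exact h.not_hit
    · exact not_hit_after ht hst.ne' (hin s hes hst.le)
  · rw [if_pos h]
    by_cases hj : Even j
    · obtain ⟨t, het, ht, hin⟩ := exists_anti_of_entry (Or.inr h)
      refine ⟨t, het.le, Or.inr ⟨j, n + 1, by simp [cellLabel, topLabel, hj], hin t het le_rfl, ht⟩,
        fun s hes hst L => ?_⟩
      rcases hes.eq_or_lt with rfl | hes
      · intro hL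
        exact (Int.not_even_iff_odd.2 (hL.of_onHor h).2) hj
      · exact not_hit_after ht hst.ne' (hin s hes hst.le)
    · exact ⟨e, le_rfl, Or.inl ⟨by simp [topLabel, hj], j, n + 1, Int.not_even_iff_odd.1 hj, h⟩,
        fun s hes hst => absurd hes (not_le.2 hst)⟩

open Classical in
-- Mirror image of `hit_after_exit`. The column to the left carries the same label as the column to
-- the right, so both lemmas use the same pair of candidates.
theorem hit_before_entry {j n : ℤ} {e : ℝ} (h : G.OnVert j n e ∨ G.OnHor j n e) :
    ∃ t, t ≤ e ∧ G.Hit (if G.OnHor j n e then topLabel j else cellLabel (j + 1)) t ∧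
      ∀ s, t < s → s ≤ e → ∀ L, ¬ G.Hit L s := by
  rcases h with h | h
  · rw [if_neg h.not_onHor, ← cellLabel_sub_one]
    obtain ⟨t, het, ht, hin⟩ := exists_anti_of_exit (G := G) (j := j - 1) (n := n) (e := e)
      (Or.inl (by rwa [sub_add_cancel]))
    refine ⟨t, het.le, Or.inr ⟨j - 1, n, rfl, hin t le_rfl het, ht⟩, fun s hts hse L => ?_⟩
    rcases hse.eq_or_lt with rfl | hse
    · exact h.not_hit
    · exact not_hit_after ht hts.ne (hin s hts.le hse)
  · rw [if_pos h]
    by_cases hj : Even j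
    · obtain ⟨t, het, ht, hin⟩ := exists_anti_of_exit (G := G) (j := j) (n := n - 1) (e := e)
        (Or.inr (by rwa [sub_add_cancel]))
      refine ⟨t, het.le, Or.inr ⟨j, n - 1, by simp [cellLabel, topLabel, hj], hin t le_rfl het, ht⟩,
        fun s hts hse L => ?_⟩
      rcases hse.eq_or_lt with rfl | hse
      · intro hL
        exact (Int.not_even_iff_odd.2 (hL.of_onHor h).2) hj
      · exact not_hit_after ht hts.ne (hin s hts.le hse)
    · exact ⟨e, le_rfl, Or.inl ⟨by simp [topLabel, hj], j, n, Int.not_even_iff_odd.1 hj, h⟩,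
        fun s hts hse => absurd hse (not_le.2 hts)⟩

/-- `t` enumerates the hits of the line with the antidiagonals and edges, with labels `w`. -/
structure IsCutting (G : GridLine) (t : ℤ → ℝ) (w : ℤ → HexLabel) : Prop where
  strictMono : StrictMono t
  range_eq : range t = {u | ∃ L, G.Hit L u}
  hit : ∀ n, G.Hit (w n) (t n)

theorem Hit.unique {L L' : HexLabel} {t : ℝ} (h : G.Hit L t) (h' : G.Hit L' t) : L = L' := by
  rcases h with ⟨hL, i, m, -, h⟩ | ⟨i, m, hL, h, -⟩
  · rw [hL, (h'.of_onHor h).1]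
  · rw [← hL, (h'.of_inCell h).1]

namespace IsCutting

variable {t : ℤ → ℝ} {w : ℤ → HexLabel} (hc : G.IsCutting t w)
include hc

theorem succ_eq {k : ℤ} {u : ℝ} {L : HexLabel} (hu : G.Hit L u) (hk : t k < u)
    (hno : ∀ s, t k < s → s < u → ∀ L, ¬ G.Hit L s) : t (k + 1) = u ∧ w (k + 1) = L := by
  obtain ⟨m, rfl⟩ : u ∈ range t := hc.range_eq ▸ ⟨L, hu⟩
  have h1 := hc.strictMono.lt_iff_lt.1 hk
  have h2 : ¬ k + 1 < m := fun h =>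
    hno _ (hc.strictMono (lt_add_one k)) (hc.strictMono h) _ (hc.hit _)
  obtain rfl : k + 1 = m := by omega
  exact ⟨rfl, (hc.hit _).unique hu⟩

theorem pred_eq {k : ℤ} {u : ℝ} {L : HexLabel} (hu : G.Hit L u) (hk : u < t k)
    (hno : ∀ s, u < s → s < t k → ∀ L, ¬ G.Hit L s) : t (k - 1) = u ∧ w (k - 1) = L := by
  obtain ⟨m, rfl⟩ : u ∈ range t := hc.range_eq ▸ ⟨L, hu⟩
  have h1 := hc.strictMono.lt_iff_lt.1 hk
  have h2 : ¬ m < k - 1 := fun h =>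
    hno _ (hc.strictMono h) (hc.strictMono (sub_one_lt k)) _ (hc.hit _)
  obtain rfl : k - 1 = m := by omega
  exact ⟨rfl, (hc.hit _).unique hu⟩

end IsCutting


/-! ### Main diagonals and sandwiched letters -/

theorem OnVert.lt_of_inCell {j n : ℤ} {e s : ℝ} (h : G.OnVert j n e) (hs : G.InCell j n s) :
    e < s := by
  rw [← a_lt_iff (G := G), h.1]; exact hs.1

theorem OnHor.lt_of_inCell {j n : ℤ} {e s : ℝ} (h : G.OnHor j n e) (hs : G.InCell j n s) :
    e < s := by
  rw [← b_lt_iff (G := G), h.2.2]; exact hs.2.2.1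

theorem OnVert.gt_of_inCell {j n : ℤ} {e s : ℝ} (h : G.OnVert (j + 1) n e)
    (hs : G.InCell j n s) : s < e := by
  rw [← a_lt_iff (G := G), h.1]; exact hs.2.1

theorem OnHor.gt_of_inCell {j n : ℤ} {e s : ℝ} (h : G.OnHor j (n + 1) e)
    (hs : G.InCell j n s) : s < e := by
  rw [← b_lt_iff (G := G), h.2.2]; push_cast; exact hs.2.2.2

theorem OnVert.diag_neg {j n : ℤ} {e : ℝ} (h : G.OnVert j n e) : G.diag j n e < 0 := by
  have hw := sub_pos.2 (G.strictMono_X (lt_add_one j))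
  have := mul_pos hw (sub_pos.2 h.2.1)
  unfold diag; rw [h.1]; linarith

theorem OnHor.diag_pos {j n : ℤ} {e : ℝ} (h : G.OnHor j n e) : 0 < G.diag j n e := by
  unfold diag; rw [h.2.2]; linarith [h.1]

theorem OnVert.diag_pos {j n : ℤ} {e : ℝ} (h : G.OnVert (j + 1) n e) : 0 < G.diag j n e := by
  have hw := sub_pos.2 (G.strictMono_X (lt_add_one j))
  have := mul_pos hw (sub_pos.2 h.2.2)
  unfold diag; rw [h.1]; linarith

theorem OnHor.diag_neg {j n : ℤ} {e : ℝ} (h : G.OnHor j (n + 1) e) : G.diag j n e < 0 := by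
  unfold diag; rw [h.2.2]; push_cast; linarith [h.2.1]

theorem continuous_diag (j n : ℤ) : Continuous (G.diag j n) := by
  unfold diag a b; fun_prop

/-- The affine function `diag` is negative on the left and upper edges and positive on the lower and
right edges. It vanishes inside the cell exactly when its signs at entry and exit differ, that is,
for opposite edges. -/
theorem exists_diag_iff {j n : ℤ} {e e' : ℝ} (hee' : e < e') (h : G.OnVert j n e ∨ G.OnHor j n e)
    (h' : G.OnVert (j + 1) n e' ∨ G.OnHor j (n + 1) e')
    (hin : ∀ s, e < s → s < e' → G.InCell j n s) :
    (∃ s, G.InCell j n s ∧ G.diag j n s = 0) ↔ (G.OnHor j n e ↔ G.OnHor j (n + 1) e') := by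
  have key : ∀ s, G.InCell j n s → G.diag j n s = 0 → ¬ 0 < G.diag j n e * G.diag j n e' := by
    intro s hs hs0 hp
    have h1 : e < s := h.elim (fun h => h.lt_of_inCell hs) (fun h => h.lt_of_inCell hs)
    have h2 : s < e' := h'.elim (fun h => h.gt_of_inCell hs) (fun h => h.gt_of_inCell hs)
    have h3 := diag_sub (G := G) j n s e
    have h4 := diag_sub (G := G) j n s e'
    rw [hs0, sub_zero] at h3 h4
    rw [h3, h4] at hp
    nlinarith [mul_nonneg (sq_nonneg (G.α - (G.X (j + 1) - G.X j) * G.β))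
      (mul_pos (sub_pos.2 h1) (sub_pos.2 h2)).le]
  rcases h with h | h <;> rcases h' with h' | h'
  · simp only [h.not_onHor, h'.not_onHor, iff_self, iff_true]
    obtain ⟨s, ⟨h1, h2⟩, hs⟩ := intermediate_value_Ioo hee'.le (continuous_diag j n).continuousOn
      ⟨h.diag_neg, h'.diag_pos⟩
    exact ⟨s, hin s h1 h2, hs⟩
  · simp only [h.not_onHor, h', false_iff, not_true, iff_false]
    rintro ⟨s, hs, hs0⟩
    exact key s hs hs0 (mul_pos_of_neg_of_neg h.diag_neg h'.diag_neg)
  · simp only [h, h'.not_onHor, iff_false, not_true_eq_false]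
    rintro ⟨s, hs, hs0⟩
    exact key s hs hs0 (mul_pos h.diag_pos h'.diag_pos)
  · simp only [h, h', iff_self, iff_true]
    obtain ⟨s, ⟨h1, h2⟩, hs⟩ := intermediate_value_Ioo' hee'.le (continuous_diag j n).continuousOn
      ⟨h'.diag_neg, h.diag_pos⟩
    exact ⟨s, hin s h1 h2, hs⟩

/-- `u` and `s` are times of the same visit to an open cell, or the same time outside the cells. -/
def Linked (G : GridLine) (u s : ℝ) : Prop :=
  (u = s ∧ ∀ j n, ¬ G.InCell j n u) ∨ ∃ j n, G.InCell j n u ∧ G.InCell j n s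

/-- The times spent in an open cell form a convex set. A reversal of order would put a time lying
outside all cells inside one, or both visits in the same cell. -/
theorem Linked.lt {u s u' s' : ℝ} (h : G.Linked u s) (h' : G.Linked u' s') (hlt : u < u')
    (hne : ∀ j n, G.InCell j n u → ¬ G.InCell j n u') : s < s' := by
  by_contra! hcon
  rcases h with ⟨rfl, hu⟩ | ⟨j, n, hu, hs⟩ <;> rcases h' with ⟨rfl, hu'⟩ | ⟨j', n', hu', hs'⟩
  · linarith
  · exact hu _ _ (hs'.mono hu' hcon hlt.le)
  · exact hu' _ _ (hu.mono hs hlt.le hcon)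
  · rcases le_total u' s with h1 | h1
    · exact hne _ _ hu (hu.mono hs hlt.le h1)
    · have h2 := hs'.mono hu' hcon h1
      obtain ⟨rfl, rfl⟩ := hs.unique h2
      exact hne _ _ hu hu'

theorem Linked.eq_of_diagHit {u s s' : ℝ} {L L' : HexLabel} (h : G.Linked u s)
    (h' : G.Linked u s') (hs : G.DiagHit L s) (hs' : G.DiagHit L' s') : s = s' := by
  rcases h with ⟨rfl, hu⟩ | ⟨j, n, hu, hin⟩ <;> rcases h' with ⟨rfl, hu'⟩ | ⟨j', n', hu', hin'⟩
  · rfl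
  · exact absurd hu' (hu _ _)
  · exact absurd hu (hu' _ _)
  · obtain ⟨rfl, rfl⟩ := hu.unique hu'
    exact diag_unique (hs.of_inCell hin).2 (hs'.of_inCell hin').2

namespace IsCutting

variable {t : ℤ → ℝ} {w : ℤ → HexLabel} (hc : G.IsCutting t w)
include hc

open Classical in
theorem succ_label {k j n : ℤ} {e : ℝ} (hk : G.InCell j n (t k)) (hte : t k < e)
    (hin : ∀ s, t k ≤ s → s < e → G.InCell j n s)
    (he : G.OnVert (j + 1) n e ∨ G.OnHor j (n + 1) e) :
    w (k + 1) = if G.OnHor j (n + 1) e then topLabel j else cellLabel (j + 1) := by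
  obtain ⟨u, heu, hu, hno⟩ := hit_after_exit he
  refine (hc.succ_eq hu (hte.trans_le heu) fun s hs hsu L => ?_).2
  rcases lt_or_ge s e with hse | hse
  · exact not_hit_after ((hc.hit k).of_inCell hk).2 hs.ne (hin s hs.le hse)
  · exact hno s hse hsu L

open Classical in
theorem pred_label {k j n : ℤ} {e : ℝ} (hk : G.InCell j n (t k)) (hte : e < t k)
    (hin : ∀ s, e < s → s ≤ t k → G.InCell j n s) (he : G.OnVert j n e ∨ G.OnHor j n e) :
    w (k - 1) = if G.OnHor j n e then topLabel j else cellLabel (j + 1) := by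
  obtain ⟨u, heu, hu, hno⟩ := hit_before_entry he
  refine (hc.pred_eq hu (heu.trans_lt hte) fun s hs hsu L => ?_).2
  rcases le_or_gt s e with hse | hse
  · exact hno s hs hse L
  · exact not_hit_after ((hc.hit k).of_inCell hk).2 hsu.ne' (hin s hse hsu.le)

/-- Both neighbouring letters are chosen from the same two distinct labels according to the edge of
entry or exit, so they agree exactly when these edges are opposite, which is the condition for
meeting the main diagonal. -/
theorem sandwiched_iff {k j n : ℤ} (hk : G.InCell j n (t k)) :
    w (k - 1) = w (k + 1) ↔ ∃ s, G.InCell j n s ∧ G.diag j n s = 0 := by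
  classical
  obtain ⟨e, het, hine, he⟩ := exists_entry hk
  obtain ⟨e', hte', hine', he'⟩ := exists_exit hk
  rw [exists_diag_iff (het.trans hte') he he' fun s h1 h2 => (le_total s (t k)).elim
    (fun h => hine s h1 h) (fun h => hine' s h h2)]
  rw [hc.succ_label hk hte' hine' he', hc.pred_label hk het hine he]
  have := cellLabel_succ_ne_topLabel j
  by_cases h1 : G.OnHor j n e <;> by_cases h2 : G.OnHor j (n + 1) e' <;>
    simp [h1, h2, this, this.symm]

/-- With `edge_pred`: an edge of side A separates two cells of one column, whose antidiagonals are
the adjacent hits. Letters A are therefore always sandwiched, in agreement with the invariance of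
these edges under γ. -/
theorem edge_succ {k j n : ℤ} (hk : G.OnHor j n (t k)) :
    w (k + 1) = cellLabel j := by
  obtain ⟨u, heu, hu, hin⟩ := exists_anti_of_entry (Or.inr hk)
  exact (hc.succ_eq (Or.inr ⟨j, n, rfl, hin u heu le_rfl, hu⟩) heu
    fun s hs hsu L => not_hit_after hu hsu.ne' (hin s hs hsu.le)).2

theorem edge_pred {k j n : ℤ} (hk : G.OnHor j n (t k)) :
    w (k - 1) = cellLabel j := by
  obtain ⟨u, heu, hu, hin⟩ := exists_anti_of_exit (G := G) (j := j) (n := n - 1) (e := t k)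
    (Or.inr (by rwa [sub_add_cancel]))
  exact (hc.pred_eq (Or.inr ⟨j, n - 1, rfl, hin u le_rfl heu, hu⟩) heu
    fun s hs hsu L => not_hit_after hu hs.ne (hin s hs.le hsu)).2

theorem transition_zero (k : ℤ) : transition 0 (w k) (w (k + 1)) := by
  classical
  change diagramArrow _ _ _ _ _
  rcases hc.hit k with ⟨hL, j, n, hj, h⟩ | ⟨j, n, hL, h, -⟩
  · rw [hL, hc.edge_succ h, cellLabel, if_neg (Int.not_even_iff_odd.2 hj)]
    exact Or.inl ⟨rfl, rfl⟩
  · obtain ⟨e, hte, hin, he⟩ := exists_exit h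
    rw [← hL, hc.succ_label h hte hin he]
    have h' : Even (j + 1) ↔ ¬ Even j := Int.even_add_one
    unfold cellLabel topLabel diagramArrow
    by_cases hj : Even j <;> by_cases hh : G.OnHor j (n + 1) e <;> simp [hj, hh, h']

theorem exists_diagHit {k : ℤ} (hk : w (k - 1) = w (k + 1)) :
    ∃ s, G.Linked (t k) s ∧ G.DiagHit (w k) s := by
  rcases hc.hit k with ⟨hL, j, n, hj, h⟩ | ⟨j, n, hL, h, -⟩
  · exact ⟨t k, Or.inl ⟨rfl, fun i m h' => h'.not_onHor h⟩, Or.inl ⟨hL, j, n, hj, h⟩⟩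
  · obtain ⟨s, hs, hs0⟩ := (hc.sandwiched_iff h).1 hk
    exact ⟨s, Or.inr ⟨j, n, h, hs⟩, Or.inr ⟨j, n, hL, hs, hs0⟩⟩

/-- A cell whose main diagonal is hit also contains a hit with its antidiagonal, and this is the
corresponding letter. -/
theorem exists_sandwiched {s : ℝ} {L : HexLabel} (hs : G.DiagHit L s) :
    ∃ k, w (k - 1) = w (k + 1) ∧ G.Linked (t k) s := by
  rcases hs with ⟨hL, j, n, hj, h⟩ | ⟨j, n, hL, h, h0⟩
  · obtain ⟨k, rfl⟩ : s ∈ range t := hc.range_eq ▸ ⟨L, Or.inl ⟨hL, j, n, hj, h⟩⟩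
    exact ⟨k, by rw [hc.edge_succ h, hc.edge_pred h], Or.inl ⟨rfl, fun i m h' => h'.not_onHor h⟩⟩
  · obtain ⟨e, hes, hine, he⟩ := exists_entry h
    obtain ⟨u, heu, hu, hin⟩ := exists_anti_of_entry he
    obtain ⟨k, rfl⟩ : u ∈ range t :=
      hc.range_eq ▸ ⟨_, Or.inr ⟨j, n, rfl, hin u heu le_rfl, hu⟩⟩
    exact ⟨k, (hc.sandwiched_iff (hin _ heu le_rfl)).2 ⟨s, h, h0⟩,
      Or.inr ⟨j, n, hin _ heu le_rfl, h⟩⟩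

/-- The subword of the sandwiched letters lists the hits with the main diagonals. -/
theorem derived {φ : ℤ → ℤ} {v : ℤ → HexLabel} (hφ : StrictMono φ)
    (hr : range φ = {n | w (n - 1) = w (n + 1)}) (hv : ∀ n, v n = w (φ n)) :
    ∃ t' : ℤ → ℝ, StrictMono t' ∧ range t' = {u | ∃ L, G.DiagHit L u} ∧
      ∀ n, G.DiagHit (v n) (t' n) := by
  have hs : ∀ n, w (φ n - 1) = w (φ n + 1) := fun n => by
    have : φ n ∈ {n | w (n - 1) = w (n + 1)} := hr ▸ mem_range_self n
    exact this
  choose t' hl ht' using fun n => hc.exists_diagHit (hs n)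
  refine ⟨t', fun m n hmn => ?_, ?_, fun n => by rw [hv]; exact ht' n⟩
  · have hlt := hc.strictMono (hφ hmn)
    -- Two different hits cannot lie in one cell, since `anti` is strictly increasing and vanishes
    -- at both.
    refine (hl m).lt (hl n) hlt fun i j h h' => ?_
    have := anti_lt_iff (G := G) (j := i) (n := j).2 hlt
    rw [((hc.hit _).of_inCell h).2, ((hc.hit _).of_inCell h').2] at this
    exact lt_irrefl _ this
  · ext u
    constructor
    · rintro ⟨n, rfl⟩
      exact ⟨_, ht' n⟩
    · rintro ⟨L, hu⟩
      obtain ⟨k, hk, hlk⟩ := hc.exists_sandwiched hu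
      obtain ⟨n, rfl⟩ : k ∈ range φ := hr ▸ hk
      exact ⟨n, (hl n).eq_of_diagHit hlk (ht' n) hu⟩

end IsCutting

end GridLine

/-! ### Existence of derived sequences -/

/-- A set of integers unbounded in both directions is order isomorphic to ℤ. -/
theorem exists_strictMono_range_eq {S : Set ℤ} (h : ∀ n, (∃ m ∈ S, n < m) ∧ ∃ m ∈ S, m < n) :
    ∃ φ : ℤ → ℤ, StrictMono φ ∧ range φ = S := by
  classical
  have : Nonempty S := let ⟨m, hm, _⟩ := (h 0).1; ⟨⟨m, hm⟩⟩
  have : NoMaxOrder S := ⟨fun a => let ⟨m, hm, h'⟩ := (h a).1; ⟨⟨m, hm⟩, h'⟩⟩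
  have : NoMinOrder S := ⟨fun a => let ⟨m, hm, h'⟩ := (h a).2; ⟨⟨m, hm⟩, h'⟩⟩
  let _ : LocallyFiniteOrder S := Subtype.instLocallyFiniteOrder _
  let _ : SuccOrder S := LinearLocallyFiniteOrder.succOrder S
  let _ : PredOrder S := LinearLocallyFiniteOrder.predOrder S
  let e : S ≃o ℤ := orderIsoIntOfLinearSuccPredArch
  refine ⟨fun n => e.symm n, fun m n hmn => e.symm.strictMono hmn, ?_⟩
  ext k
  constructor
  · rintro ⟨n, rfl⟩
    exact (e.symm n).2
  · intro hk
    exact ⟨e ⟨k, hk⟩, by simp⟩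

/-- A finite check on seven letters: a path in the diagram cannot have five consecutive letters that
are not sandwiched. This purely combinatorial fact makes derived words bi-infinite. -/
theorem exists_sandwiched_near {w : ℤ → HexLabel} (hw : ∀ n, transition 0 (w n) (w (n + 1)))
    (n : ℤ) : ∃ m, n - 2 ≤ m ∧ m ≤ n + 2 ∧ w (m - 1) = w (m + 1) := by
  have h : ∀ m k, k = m + 1 → diagramArrow HexLabel.A HexLabel.C HexLabel.B (w m) (w k) := by
    rintro m _ rfl; exact hw m
  by_contra! hcon
  have c0 := hcon (n - 2) (by omega) (by omega)
  have c1 := hcon (n - 1) (by omega) (by omega)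
  have c2 := hcon n (by omega) (by omega)
  have c3 := hcon (n + 1) (by omega) (by omega)
  have c4 := hcon (n + 2) (by omega) (by omega)
  have h0 := h (n - 3) (n - 2) (by ring)
  have h1 := h (n - 2) (n - 1) (by ring)
  have h2 := h (n - 1) n (by ring)
  have h3 := h n (n + 1) (by ring)
  have h4 := h (n + 1) (n + 2) (by ring)
  have h5 := h (n + 2) (n + 3) (by ring)
  rw [show n - 2 - 1 = n - 3 by ring, show n - 2 + 1 = n - 1 by ring] at c0
  rw [show n - 1 - 1 = n - 2 by ring, show n - 1 + 1 = n by ring] at c1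
  rw [show n + 1 - 1 = n by ring, show n + 1 + 1 = n + 2 by ring] at c3
  rw [show n + 2 - 1 = n + 1 by ring, show n + 2 + 1 = n + 3 by ring] at c4
  unfold diagramArrow at *
  generalize w (n - 3) = x0 at *
  generalize w (n - 2) = x1 at *
  generalize w (n - 1) = x2 at *
  generalize w n = x3 at *
  generalize w (n + 1) = x4 at *
  generalize w (n + 2) = x5 at *
  generalize w (n + 3) = x6 at *
  clear h hcon hw
  cases x2 <;> cases x3 <;> cases x4 <;> simp at h2 h3 c2 <;> cases x1 <;> simp at h1 c1 <;>
    cases x5 <;> simp at h4 c3 <;> cases x0 <;> simp at h0 c0 <;> cases x6 <;> simp at h5 c4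

/-- The permutation of labels that transforms the `i`-th diagram into the first one. -/
def relabel : Fin 6 → HexLabel → HexLabel :=
  ![fun L => HexLabel.casesOn L HexLabel.A HexLabel.B HexLabel.C,
    fun L => HexLabel.casesOn L HexLabel.C HexLabel.B HexLabel.A,
    fun L => HexLabel.casesOn L HexLabel.B HexLabel.C HexLabel.A,
    fun L => HexLabel.casesOn L HexLabel.B HexLabel.A HexLabel.C,
    fun L => HexLabel.casesOn L HexLabel.C HexLabel.A HexLabel.B,
    fun L => HexLabel.casesOn L HexLabel.A HexLabel.C HexLabel.B]

theorem relabel_injective (i : Fin 6) : Function.Injective (relabel i) := by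
  intro x y
  fin_cases i <;> cases x <;> cases y <;> simp [relabel]

theorem relabel_surjective (i : Fin 6) : Function.Surjective (relabel i) := by
  intro y
  fin_cases i <;> cases y <;>
    first | exact ⟨HexLabel.A, rfl⟩ | exact ⟨HexLabel.B, rfl⟩ | exact ⟨HexLabel.C, rfl⟩

theorem transition_relabel (i : Fin 6) (x y : HexLabel) :
    transition 0 (relabel i x) (relabel i y) ↔ transition i x y := by
  fin_cases i <;> cases x <;> cases y <;> simp [relabel, transition, diagramArrow]

theorem Admissible.exists_isDerived {w : ℤ → HexLabel} (hw : Admissible w) :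
    ∃ v, IsDerived w v := by
  obtain ⟨i, hi⟩ := hw
  have h0 : ∀ n, transition 0 ((relabel i ∘ w) n) ((relabel i ∘ w) (n + 1)) := fun n =>
    (transition_relabel i _ _).2 (hi n)
  have hnear : ∀ n : ℤ, ∃ m, n - 2 ≤ m ∧ m ≤ n + 2 ∧ w (m - 1) = w (m + 1) := fun n => by
    obtain ⟨m, h1, h2, h3⟩ := exists_sandwiched_near h0 n
    exact ⟨m, h1, h2, relabel_injective i h3⟩
  obtain ⟨φ, hφ, hr⟩ := exists_strictMono_range_eq (S := {n | w (n - 1) = w (n + 1)}) fun n => by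
    obtain ⟨m, h1, h2, h3⟩ := hnear (n + 3)
    obtain ⟨m', h1', h2', h3'⟩ := hnear (n - 3)
    exact ⟨⟨m, h3, by omega⟩, ⟨m', h3', by omega⟩⟩
  exact ⟨w ∘ φ, ⟨i, hi⟩, φ, hφ, hr, fun n => rfl⟩

/-! ### The grid of the hexagon tiling -/

/-- The positions of the vertical grid lines, in lattice coordinates. -/
def hexCol (j : ℤ) : ℝ := (3 * j - 2 + ((j % 2 : ℤ) : ℝ)) / 2

theorem hexCol_even (m : ℤ) : hexCol (2 * m) = 3 * m - 1 := by
  unfold hexCol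
  rw [show (2 * m) % 2 = 0 by omega]
  push_cast; ring

theorem hexCol_odd (m : ℤ) : hexCol (2 * m + 1) = 3 * m + 1 := by
  unfold hexCol
  rw [show (2 * m + 1) % 2 = 1 by omega]
  push_cast; ring

theorem hexCol_odd_add_one (m : ℤ) : hexCol (2 * m + 1 + 1) = 3 * m + 2 := by
  rw [show 2 * m + 1 + 1 = 2 * (m + 1) by ring, hexCol_even]
  push_cast; ring

theorem strictMono_hexCol : StrictMono hexCol := by
  refine strictMono_int_of_lt_succ fun j => ?_
  obtain ⟨m, rfl | rfl⟩ := Int.even_or_odd' j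
  · rw [hexCol_even, hexCol_odd]; linarith
  · rw [hexCol_odd, hexCol_odd_add_one]; linarith

/-- A line in lattice coordinates, whose direction lies in the first open sector. -/
def hexGridLine (p u : Plane) (hA : 0 < coordA u) (hB : 0 < coordB u)
    (hns : ∀ t : ℝ, toSurface (p + t • u) ∉ hexSing) : GridLine where
  X := hexCol
  strictMono_X := strictMono_hexCol
  a₀ := coordA p
  α := coordA u
  b₀ := coordB p
  β := coordB u
  α_pos := hA
  β_pos := hB
  generic := by
    intro t j n h1 h2
    refine hns t ((mem_hexSing_iff _).2 ?_)
    simp only [coordA_add, coordB_add, coordA_smul, coordB_smul]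
    rw [mul_comm t, mul_comm t, h1, h2]
    obtain ⟨m, rfl | rfl⟩ := Int.even_or_odd' j
    · exact ⟨m - 1, n, Or.inr (by rw [hexCol_even]; push_cast; ring), rfl⟩
    · exact ⟨m, n, Or.inl (by rw [hexCol_odd]), rfl⟩

section HexGridLine

variable {p u : Plane} (hA : 0 < coordA u) (hB : 0 < coordB u)
  (hns : ∀ t : ℝ, toSurface (p + t • u) ∉ hexSing)

theorem hexGridLine_a (t : ℝ) : (hexGridLine p u hA hB hns).a t = coordA (p + t • u) := by
  simp [GridLine.a, hexGridLine, mul_comm]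

theorem hexGridLine_b (t : ℝ) : (hexGridLine p u hA hB hns).b t = coordB (p + t • u) := by
  simp [GridLine.b, hexGridLine, mul_comm]

theorem hexGridLine_X (j : ℤ) : (hexGridLine p u hA hB hns).X j = hexCol j := rfl

/-- Sides are closed segments, whereas the grid notions are open. The endpoints are singular points,
which the line avoids; the next four lemmas rest on the same remark. -/
theorem hexGridLine_onHor_iff (m n : ℤ) (t : ℝ) :
    (hexGridLine p u hA hB hns).OnHor (2 * m + 1) n t ↔
      coordB (p + t • u) = n ∧ 3 * m + 1 ≤ coordA (p + t • u) ∧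
        coordA (p + t • u) ≤ 3 * m + 2 := by
  rw [GridLine.OnHor, hexGridLine_a, hexGridLine_b, hexGridLine_X, hexGridLine_X, hexCol_odd,
    hexCol_odd_add_one]
  constructor
  · rintro ⟨h1, h2, h3⟩
    exact ⟨h3, h1.le, h2.le⟩
  · rintro ⟨h1, h2, h3⟩
    refine ⟨h2.lt_of_ne fun h => hns t ?_, h3.lt_of_ne fun h => hns t ?_, h1⟩
    · exact (mem_hexSing_iff _).2 ⟨m, n, Or.inl h.symm, h1⟩
    · exact (mem_hexSing_iff _).2 ⟨m, n, Or.inr h, h1⟩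

theorem hexGridLine_anti_even_iff (m n : ℤ) (t : ℝ) :
    ((hexGridLine p u hA hB hns).InCell (2 * m) n t ∧
      (hexGridLine p u hA hB hns).anti (2 * m) n t = 0) ↔
      n ≤ coordB (p + t • u) ∧ coordB (p + t • u) ≤ n + 1 ∧
        coordA (p + t • u) + 2 * (coordB (p + t • u) - n) = 3 * m + 1 := by
  rw [GridLine.InCell, GridLine.anti, hexGridLine_a, hexGridLine_b, hexGridLine_X, hexGridLine_X,
    hexCol_odd, hexCol_even]
  constructor
  · rintro ⟨⟨h1, h2, h3, h4⟩, h5⟩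
    exact ⟨h3.le, h4.le, by linarith⟩
  · rintro ⟨h1, h2, h3⟩
    have h4 := h1.lt_of_ne fun h => hns t <|
      (mem_hexSing_iff _).2 ⟨m, n, Or.inl (by linarith), h.symm⟩
    have h5 := h2.lt_of_ne fun h => hns t <|
      (mem_hexSing_iff _).2 ⟨m - 1, n + 1, Or.inr (by push_cast; linarith), by push_cast; exact h⟩
    exact ⟨⟨by linarith, by linarith, h4, h5⟩, by linarith⟩

theorem hexGridLine_anti_odd_iff (m n : ℤ) (t : ℝ) :
    ((hexGridLine p u hA hB hns).InCell (2 * m + 1) n t ∧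
      (hexGridLine p u hA hB hns).anti (2 * m + 1) n t = 0) ↔
      n ≤ coordB (p + t • u) ∧ coordB (p + t • u) ≤ n + 1 ∧
        coordA (p + t • u) + (coordB (p + t • u) - n) = 3 * m + 2 := by
  rw [GridLine.InCell, GridLine.anti, hexGridLine_a, hexGridLine_b, hexGridLine_X, hexGridLine_X,
    hexCol_odd, hexCol_odd_add_one]
  constructor
  · rintro ⟨⟨h1, h2, h3, h4⟩, h5⟩
    exact ⟨h3.le, h4.le, by linarith⟩
  · rintro ⟨h1, h2, h3⟩
    have h4 := h1.lt_of_ne fun h => hns t <|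
      (mem_hexSing_iff _).2 ⟨m, n, Or.inr (by linarith), h.symm⟩
    have h5 := h2.lt_of_ne fun h => hns t <|
      (mem_hexSing_iff _).2 ⟨m, n + 1, Or.inl (by linarith), by push_cast; exact h⟩
    exact ⟨⟨by linarith, by linarith, h4, h5⟩, by linarith⟩

theorem hexGridLine_diag_even_iff (m n : ℤ) (t : ℝ) :
    ((hexGridLine p u hA hB hns).InCell (2 * m) n t ∧
      (hexGridLine p u hA hB hns).diag (2 * m) n t = 0) ↔
      n ≤ coordB (p + t • u) ∧ coordB (p + t • u) ≤ n + 1 ∧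
        -coordA (p + t • u) + 2 * (coordB (p + t • u) - n) = 3 * (-m : ℤ) + 1 := by
  rw [GridLine.InCell, GridLine.diag, hexGridLine_a, hexGridLine_b, hexGridLine_X, hexGridLine_X,
    hexCol_odd, hexCol_even]
  push_cast
  constructor
  · rintro ⟨⟨h1, h2, h3, h4⟩, h5⟩
    exact ⟨h3.le, h4.le, by linarith⟩
  · rintro ⟨h1, h2, h3⟩
    have h4 := h1.lt_of_ne fun h => hns t <|
      (mem_hexSing_iff _).2 ⟨m - 1, n, Or.inr (by push_cast; linarith), h.symm⟩
    have h5 := h2.lt_of_ne fun h => hns t <|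
      (mem_hexSing_iff _).2 ⟨m, n + 1, Or.inl (by linarith), by push_cast; exact h⟩
    exact ⟨⟨by linarith, by linarith, h4, h5⟩, by linarith⟩

theorem hexGridLine_diag_odd_iff (m n : ℤ) (t : ℝ) :
    ((hexGridLine p u hA hB hns).InCell (2 * m + 1) n t ∧
      (hexGridLine p u hA hB hns).diag (2 * m + 1) n t = 0) ↔
      n ≤ coordB (p + t • u) ∧ coordB (p + t • u) ≤ n + 1 ∧
        -coordA (p + t • u) + (coordB (p + t • u) - n) = 3 * (-m - 1 : ℤ) + 2 := by
  rw [GridLine.InCell, GridLine.diag, hexGridLine_a, hexGridLine_b, hexGridLine_X, hexGridLine_X,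
    hexCol_odd, hexCol_odd_add_one]
  push_cast
  constructor
  · rintro ⟨⟨h1, h2, h3, h4⟩, h5⟩
    exact ⟨h3.le, h4.le, by linarith⟩
  · rintro ⟨h1, h2, h3⟩
    have h4 := h1.lt_of_ne fun h => hns t <|
      (mem_hexSing_iff _).2 ⟨m, n, Or.inl (by linarith), h.symm⟩
    have h5 := h2.lt_of_ne fun h => hns t <|
      (mem_hexSing_iff _).2 ⟨m, n + 1, Or.inr (by linarith), by push_cast; exact h⟩
    exact ⟨⟨by linarith, by linarith, h4, h5⟩, by linarith⟩

theorem exists_even_iff {P : ℤ → Prop} :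
    (∃ j, GridLine.cellLabel j = HexLabel.B ∧ P j) ↔ ∃ m, P (2 * m) := by
  constructor
  · rintro ⟨j, hj, h⟩
    obtain ⟨m, rfl | rfl⟩ := Int.even_or_odd' j
    · exact ⟨m, h⟩
    · simp [GridLine.cellLabel] at hj
  · rintro ⟨m, h⟩
    exact ⟨2 * m, by simp [GridLine.cellLabel], h⟩

theorem exists_odd_iff {P : ℤ → Prop} :
    (∃ j, GridLine.cellLabel j = HexLabel.C ∧ P j) ↔ ∃ m, P (2 * m + 1) := by
  constructor
  · rintro ⟨j, hj, h⟩
    obtain ⟨m, rfl | rfl⟩ := Int.even_or_odd' j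
    · simp [GridLine.cellLabel] at hj
    · exact ⟨m, h⟩
  · rintro ⟨m, h⟩
    exact ⟨2 * m + 1, by simp [GridLine.cellLabel], h⟩

theorem hexGridLine_hit_iff (L : HexLabel) (t : ℝ) :
    (hexGridLine p u hA hB hns).Hit L t ↔ toSurface (p + t • u) ∈ hexSide L := by
  unfold GridLine.Hit
  cases L
  · rw [mem_hexSide_A_iff]
    simp only [GridLine.cellLabel_ne_A, false_and, exists_false, or_false, true_and]
    simp only [← hexGridLine_onHor_iff hA hB hns]
    constructor
    · rintro ⟨_, n, ⟨m, rfl⟩, h⟩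
      exact ⟨m, n, h⟩
    · rintro ⟨m, n, h⟩
      exact ⟨_, n, ⟨m, rfl⟩, h⟩
  · rw [mem_hexSide_B_iff]
    simp only [← hexGridLine_anti_even_iff hA hB hns, exists_and_left, exists_even_iff,
      reduceCtorEq, false_and, false_or]
  · rw [mem_hexSide_C_iff]
    simp only [← hexGridLine_anti_odd_iff hA hB hns, exists_and_left, exists_odd_iff,
      reduceCtorEq, false_and, false_or]

/-- Since γ changes the sign of a, it exchanges column 2m with -2m and column 2m + 1 with -2m - 1,
and turns main diagonals into antidiagonals. -/
theorem hexGridLine_diagHit_iff (L : HexLabel) (t : ℝ) :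
    (hexGridLine p u hA hB hns).DiagHit L t ↔
      toSurface (planeMap veechGamma (p + t • u)) ∈ hexSide L := by
  unfold GridLine.DiagHit
  cases L
  · rw [mem_hexSide_A_iff, coordA_veechGamma, coordB_veechGamma]
    simp only [GridLine.cellLabel_ne_A, false_and, exists_false, or_false, true_and]
    constructor
    · rintro ⟨_, n, ⟨m, rfl⟩, h⟩
      obtain ⟨h1, h2, h3⟩ := (hexGridLine_onHor_iff hA hB hns m n t).1 h
      exact ⟨-m - 1, n, h1, by push_cast; linarith, by push_cast; linarith⟩
    · rintro ⟨m, n, h1, h2, h3⟩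
      exact ⟨_, n, ⟨-m - 1, rfl⟩, (hexGridLine_onHor_iff hA hB hns _ _ t).2
        ⟨h1, by push_cast; linarith, by push_cast; linarith⟩⟩
  · rw [mem_hexSide_B_iff, coordA_veechGamma, coordB_veechGamma]
    simp only [exists_and_left, exists_even_iff, reduceCtorEq, false_and, false_or]
    simp only [hexGridLine_diag_even_iff hA hB hns]
    exact ⟨fun ⟨m, h⟩ => ⟨-m, h⟩, fun ⟨m, h⟩ => ⟨-m, by rwa [neg_neg]⟩⟩
  · rw [mem_hexSide_C_iff, coordA_veechGamma, coordB_veechGamma]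
    simp only [exists_and_left, exists_odd_iff, reduceCtorEq, false_and, false_or]
    simp only [hexGridLine_diag_odd_iff hA hB hns]
    exact ⟨fun ⟨m, h⟩ => ⟨-m - 1, h⟩,
      fun ⟨m, h⟩ => ⟨-m - 1, by rwa [neg_sub, sub_neg_eq_add, add_sub_cancel_left]⟩⟩

end HexGridLine

/-! ### Symmetries of the labelled sides -/

/-- Reversing a segment changes only the sign of its half edge, and twice the midpoint is a gluing
vector, so the opposite side is the same side of the surface. Linear symmetries thus need to be
checked on midpoints and half edges only up to sign. -/
theorem mem_hexSide_of_signs {x m h : Plane} {L : HexLabel} (hm : m = sideMid L ∨ m = -sideMid L)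
    (hh : h = sideHalf L ∨ h = -sideHalf L) :
    (∃ s : ℝ, -1 ≤ s ∧ s ≤ 1 ∧ x - (m + s • h) ∈ hexLattice) ↔ toSurface x ∈ hexSide L := by
  have hmid : (2 : ℝ) • sideMid L ∈ hexLattice := by
    rw [sideMid, smul_smul]
    norm_num
    exact AddSubgroup.subset_closure (mem_range_self L)
  rw [mem_hexSide_iff]
  have h1 : (∃ s : ℝ, -1 ≤ s ∧ s ≤ 1 ∧ x - (m + s • h) ∈ hexLattice) ↔
      ∃ s : ℝ, -1 ≤ s ∧ s ≤ 1 ∧ x - (m + s • sideHalf L) ∈ hexLattice := by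
    rcases hh with rfl | rfl
    · rfl
    · rw [← (Equiv.neg ℝ).exists_congr_right]
      refine exists_congr fun s => ?_
      rw [Equiv.neg_apply, smul_neg, neg_smul, neg_neg, neg_le_neg_iff, neg_le, and_left_comm]
  rw [h1]
  refine exists_congr fun s => and_congr_right fun _ => and_congr_right fun _ => ?_
  rcases hm with rfl | rfl
  · rfl
  · rw [show x - (-sideMid L + s • sideHalf L) =
      (x - (sideMid L + s • sideHalf L)) + (2 : ℝ) • sideMid L by module]
    exact hexLattice.add_mem_cancel_right hmid

theorem planeMap_nu_sideMid (i : Fin 6) (L : HexLabel) :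
    planeMap (nu i) (sideMid L) = sideMid (relabel i L) ∨
      planeMap (nu i) (sideMid L) = -sideMid (relabel i L) := by
  fin_cases i <;> cases L <;>
    first
    | left; apply plane_ext_coord <;>
        simp [coordA_nu, coordB_nu, nuCoeff, relabel, coordA_sideMid, coordB_sideMid] <;>
        norm_num; done
    | right; apply plane_ext_coord <;>
        simp [coordA_nu, coordB_nu, nuCoeff, relabel, coordA_sideMid, coordB_sideMid] <;>
        norm_num

theorem planeMap_nu_sideHalf (i : Fin 6) (L : HexLabel) :
    planeMap (nu i) (sideHalf L) = sideHalf (relabel i L) ∨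
      planeMap (nu i) (sideHalf L) = -sideHalf (relabel i L) := by
  fin_cases i <;> cases L <;>
    first
    | left; apply plane_ext_coord <;>
        simp [coordA_nu, coordB_nu, nuCoeff, relabel, coordA_sideHalf, coordB_sideHalf] <;>
        norm_num; done
    | right; apply plane_ext_coord <;>
        simp [coordA_nu, coordB_nu, nuCoeff, relabel, coordA_sideHalf, coordB_sideHalf] <;>
        norm_num

theorem mem_hexSide_nu_iff (i : Fin 6) (L : HexLabel) (x : Plane) :
    toSurface (planeMap (nu i) x) ∈ hexSide (relabel i L) ↔ toSurface x ∈ hexSide L := by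
  rw [← mem_hexSide_of_signs (planeMap_nu_sideMid i L) (planeMap_nu_sideHalf i L), mem_hexSide_iff]
  refine exists_congr fun s => and_congr_right fun _ => and_congr_right fun _ => ?_
  rw [← planeMap_smul, ← planeMap_add, ← planeMap_sub]
  exact (nu_mem_hexStabilizer i).1 _

theorem mem_hexSide_neg_iff (L : HexLabel) (x : Plane) :
    toSurface (-x) ∈ hexSide L ↔ toSurface x ∈ hexSide L := by
  rw [← mem_hexSide_of_signs (x := -x) (Or.inr rfl) (Or.inr rfl), mem_hexSide_iff]
  refine exists_congr fun s => and_congr_right fun _ => and_congr_right fun _ => ?_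
  rw [show -x - (-sideMid L + s • -sideHalf L) = -(x - (sideMid L + s • sideHalf L)) by module]
  exact neg_mem_iff

theorem mem_hexSing_neg_iff (x : Plane) : toSurface (-x) ∈ hexSing ↔ toSurface x ∈ hexSing := by
  have h : ∀ y : Plane, toSurface y ∈ hexSing → toSurface (-y) ∈ hexSing := by
    intro y hy
    rw [mem_hexSing_iff] at hy ⊢
    obtain ⟨m, n, h1 | h1, h2⟩ := hy
    · exact ⟨-m - 1, -n, Or.inr (by rw [coordA_neg, h1]; push_cast; ring), by simp [h2]⟩
    · exact ⟨-m - 1, -n, Or.inl (by rw [coordA_neg, h1]; push_cast; ring), by simp [h2]⟩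
  exact ⟨fun hx => by simpa using h _ hx, h x⟩

/-! ### Derivation of cutting sequences -/

/-- A symmetry `S` carries a direction of the `i`-th open sector into the first one. -/
theorem exists_sector_symmetry {i : Fin 6} {u : Plane} (hi : 0 < sectorForm i u) :
    ∃ S : Plane → Plane, (∀ x t y, S (x + t • y) = S x + (t : ℝ) • S y) ∧ 0 < coordA (S u) ∧
      0 < coordB (S u) ∧ (∀ x, toSurface (S x) ∈ hexSing ↔ toSurface x ∈ hexSing) ∧
      (∀ L x, toSurface (S x) ∈ hexSide (relabel i L) ↔ toSurface x ∈ hexSide L) ∧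
      ∀ x, planeMap veechGamma (S x) = S (planeMap (gammaConj i) x) := by
  rcases mul_pos_iff.1 hi with ⟨hA, hB⟩ | ⟨hA, hB⟩
  · refine ⟨planeMap (nu i), fun x t y => by rw [planeMap_add, planeMap_smul], hA, hB,
      (nu_mem_hexStabilizer i).2.1, fun L x => mem_hexSide_nu_iff i L x,
      fun x => (nu_gammaConj i x).symm⟩
  · refine ⟨fun x => -planeMap (nu i) x, fun x t y => ?_, ?_, ?_, fun x => ?_, fun L x => ?_,
      fun x => ?_⟩
    · beta_reduce; rw [planeMap_add, planeMap_smul]; module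
    · simpa using hA
    · simpa using hB
    · rw [mem_hexSing_neg_iff]; exact (nu_mem_hexStabilizer i).2.1 x
    · rw [mem_hexSide_neg_iff]; exact mem_hexSide_nu_iff i L x
    · beta_reduce; rw [nu_gammaConj, planeMap_neg]

/-- One derivation: transport the line to the first sector by a symmetry, read hits with
antidiagonals as the word and hits with main diagonals as the derived word, then transport back,
which turns γ into γ_i. -/
theorem isCuttingSequence_of_isDerived {p u : Plane} (hns : ∀ t : ℝ, toSurface (p + t • u) ∉ hexSing) {i : Fin 6}
    (hi : 0 < sectorForm i u) {w : ℤ → HexLabel}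
    (hw : IsCuttingSequence hexSide (fun t => toSurface (p + t • u)) w) :
    Admissible w ∧ ∀ v, IsDerived w v →
      IsCuttingSequence hexSide (fun t => toSurface (planeMap (gammaConj i) (p + t • u))) v := by
  obtain ⟨S, hlin, hA, hB, hsing, hside, hgam⟩ := exists_sector_symmetry hi
  have hns' : ∀ t : ℝ, toSurface (S p + t • S u) ∉ hexSing := fun t => by
    rw [← hlin, hsing]; exact hns t
  obtain ⟨t, hmono, hrange, hlab⟩ := hw
  have hhit : ∀ L t, (hexGridLine (S p) (S u) hA hB hns').Hit (relabel i L) t ↔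
      toSurface (p + t • u) ∈ hexSide L := fun L t => by
    rw [hexGridLine_hit_iff, ← hlin, hside]
  have hdiag : ∀ L t, (hexGridLine (S p) (S u) hA hB hns').DiagHit (relabel i L) t ↔
      toSurface (planeMap (gammaConj i) (p + t • u)) ∈ hexSide L := fun L t => by
    rw [hexGridLine_diagHit_iff, ← hlin, hgam, hside]
  have hc : (hexGridLine (S p) (S u) hA hB hns').IsCutting t (relabel i ∘ w) :=
    ⟨hmono, by
      rw [hrange]; ext r
      refine Iff.trans (exists_congr fun L => (hhit L r).symm) ?_
      change _ ↔ ∃ L, _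
      exact ((relabel_surjective i).exists (p := fun L =>
        (hexGridLine (S p) (S u) hA hB hns').Hit L r)).symm,
      fun n => (hhit _ _).2 (hlab n)⟩
  refine ⟨⟨i, fun n => (transition_relabel i _ _).1 (hc.transition_zero n)⟩, ?_⟩
  rintro v ⟨-, φ, hφ, hr, hv⟩
  obtain ⟨t', h1, h2, h3⟩ := hc.derived (v := relabel i ∘ v) hφ
    (by rw [hr]; ext n; exact (relabel_injective i).eq_iff.symm)
    (fun n => by simp [hv])
  refine ⟨t', h1, ?_, fun n => (hdiag _ _).1 (h3 n)⟩
  rw [h2]; ext r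
  exact (relabel_surjective i).exists.trans (exists_congr fun L => hdiag L r)

/-- After j steps the word is the cutting sequence of the image under `gammaProd s j`, so the next
derivation needs only that the image direction lies in the open sector `s j`. -/
theorem iterated_derivation {p u : Plane} (hns : ∀ t : ℝ, toSurface (p + t • u) ∉ hexSing)
    {w : ℤ → HexLabel} (hw : IsCuttingSequence hexSide (fun t => toSurface (p + t • u)) w)
    (s : ℕ → Fin 6) (k : ℕ)
    (hs : ∀ j < k, 0 < sectorForm (s j) (planeMap (gammaProd s j) u)) :
    (∃ v, IsIteratedDerived k w v) ∧ ∀ v, IsIteratedDerived k w v →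
      IsCuttingSequence hexSide
        (fun t => toSurface (planeMap (gammaProd s k) (p + t • u))) v := by
  induction k with
  | zero =>
    refine ⟨⟨w, rfl⟩, ?_⟩
    rintro v rfl
    simpa [gammaProd] using hw
  | succ k ih =>
    obtain ⟨⟨v, hv⟩, hcut⟩ := ih fun j hj => hs j (hj.trans (Nat.lt_succ_self k))
    have hns' : ∀ t : ℝ, toSurface (planeMap (gammaProd s k) p + t • planeMap (gammaProd s k) u) ∉
        hexSing := fun t => by
      rw [← planeMap_smul, ← planeMap_add, (gammaProd_mem_hexStabilizer s k).2.1]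
      exact hns t
    have hstep : ∀ v, IsIteratedDerived k w v → Admissible v ∧ ∀ v', IsDerived v v' →
        IsCuttingSequence hexSide
          (fun t => toSurface (planeMap (gammaProd s (k + 1)) (p + t • u))) v' := fun v hv => by
      have hcv := hcut v hv
      simp only [planeMap_add, planeMap_smul] at hcv
      have := isCuttingSequence_of_isDerived hns' (hs k (Nat.lt_succ_self k)) hcv
      simpa only [gammaProd, planeMap_mul, planeMap_add, planeMap_smul] using this
    refine ⟨?_, ?_⟩
    · obtain ⟨v', hv'⟩ := (hstep v hv).1.exists_isDerived
      exact ⟨v', v, hv, hv'⟩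
    · rintro v' ⟨v, hv, hv'⟩
      exact (hstep v hv).2 v' hv'

/-! ### Affine automorphisms -/

theorem isClosed_hexLattice : IsClosed (hexLattice : Set Plane) := by
  have h : (hexLattice : Set Plane) =
      (fun x => coordA x / 3) ⁻¹' range ((↑) : ℤ → ℝ) ∩ coordB ⁻¹' range ((↑) : ℤ → ℝ) := by
    ext x
    rw [SetLike.mem_coe, mem_hexLattice_iff]
    constructor
    · rintro ⟨m, n, h1, h2⟩
      exact ⟨⟨m, by simp [h1]⟩, ⟨n, h2.symm⟩⟩
    · rintro ⟨⟨m, h1⟩, ⟨n, h2⟩⟩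
      exact ⟨m, n, by simp only at h1; linarith, h2.symm⟩
  have hc : IsClosed (range ((↑) : ℤ → ℝ)) := Int.isClosedEmbedding_coe_real.isClosed_range
  rw [h]
  exact (hc.preimage (continuous_coordA.div_const 3)).inter (hc.preimage continuous_coordB)

instance : T2Space HexSurface := by
  have : IsClosed (hexLattice : Set Plane) := isClosed_hexLattice
  infer_instance

theorem continuous_toSurface : Continuous toSurface := continuous_quotient_mk'

theorem toSurface_surjective : Function.Surjective toSurface := Quotient.mk_surjective

theorem toSurface_add (x y : Plane) : toSurface (x + y) = toSurface x + toSurface y := rfl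

theorem toSurface_neg (x : Plane) : toSurface (-x) = -toSurface x := rfl

theorem countable_preimage_hexSing : {x | toSurface x ∈ hexSing}.Countable := by
  have h : {x | toSurface x ∈ hexSing} ⊆ (fun x => (coordA x, coordB x)) ⁻¹'
      (range fun q : ℤ × ℤ => ((q.1 : ℝ), (q.2 : ℝ))) := by
    intro x hx
    obtain ⟨m, n, h1 | h1, h2⟩ := (mem_hexSing_iff x).1 hx
    · exact ⟨(3 * m + 1, n), by simp [h1, h2]⟩
    · exact ⟨(3 * m + 2, n), by simp [h1, h2]⟩
  refine Set.Countable.mono h ((countable_range _).preimage_of_injOn ?_)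
  intro x _ y _ hxy
  simp only [Prod.mk.injEq] at hxy
  exact plane_ext_coord hxy.1 hxy.2

theorem one_lt_rank_plane : 1 < Module.rank ℝ Plane := by
  rw [rank_fin_fun]; norm_num

theorem hexSing_eq : hexSing = {toSurface (hexVertex 0), -toSurface (hexVertex 0)} := by
  ext y
  obtain ⟨x, rfl⟩ := toSurface_surjective y
  rw [mem_insert_iff, mem_singleton_iff, ← toSurface_neg, toSurface_eq_iff, toSurface_eq_iff,
    mem_hexSing_iff, mem_hexLattice_iff, mem_hexLattice_iff]
  simp only [coordA_sub, coordB_sub, coordA_neg, coordB_neg, coordA_hexVertex, coordB_hexVertex]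
  simp only [Matrix.cons_val_zero, neg_zero, sub_zero]
  constructor
  · rintro ⟨m, n, h1 | h1, h2⟩
    · exact Or.inl ⟨m, n, by linarith, h2⟩
    · exact Or.inr ⟨m + 1, n, by push_cast; linarith, h2⟩
  · rintro (⟨m, n, h1, h2⟩ | ⟨m, n, h1, h2⟩)
    · exact ⟨m, n, Or.inl (by linarith), h2⟩
    · exact ⟨m - 1, n, Or.inr (by push_cast; linarith), h2⟩

/-- The only translation that preserves the singular set is the identity. -/
theorem eq_zero_of_translate_hexSing {c : HexSurface} (h : ∀ y ∈ hexSing, y + c ∈ hexSing) :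
    c = 0 := by
  set y := toSurface (hexVertex 0) with hy
  -- The two singular points are y and -y with y of order three. If c is not 0 then it is y, and it
  -- would move -y to the non-singular point 0.
  have h3 : y + y + y = 0 := by
    rw [hy, ← toSurface_add, ← toSurface_add, show (0 : HexSurface) = toSurface 0 from rfl,
      toSurface_eq_iff, mem_hexLattice_iff]
    exact ⟨1, 0, by simp [coordA_hexVertex]; norm_num, by simp [coordB_hexVertex]⟩
  have hne : y ≠ -y := by
    rw [hy, ← toSurface_neg, Ne, toSurface_eq_iff, mem_hexLattice_iff]
    rintro ⟨m, n, h1, -⟩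
    simp [coordA_hexVertex] at h1
    have : (1 + 1 : ℤ) = 3 * m := by exact_mod_cast h1
    omega
  have h1 := h y (by rw [hexSing_eq]; simp [hy])
  have h2 := h (-y) (by rw [hexSing_eq]; simp [hy])
  rw [hexSing_eq, ← hy] at h1 h2
  rcases h1 with h1 | h1
  · simpa using h1
  · have hc : c = y := by
      rw [mem_singleton_iff] at h1
      have e1 : c = -y + -y := by
        calc c = -y + (y + c) := by abel
          _ = -y + -y := by rw [h1]
      rw [e1, eq_comm, ← sub_eq_zero, ← h3]; abel
    rw [hc, neg_add_cancel] at h2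
    rcases h2 with h2 | h2
    · rw [hc, ← h2]
    · rw [hc, ← neg_eq_zero]; exact h2.symm

/-- The difference of two such maps, lifted to the plane, is locally constant off the singular
points. These are countable, so their complement is connected and dense and the difference is a
constant translation. It preserves the singular set, hence vanishes. -/
theorem affineAutomorphism_unique {Φ Ψ : HexSurface ≃ₜ HexSurface} {η : Matrix (Fin 2) (Fin 2) ℝ}
    (hΦ : IsAffineAutomorphism Φ η) (hΨ : IsAffineAutomorphism Ψ η) : Φ = Ψ := by
  set U : Set Plane := {x | toSurface x ∈ hexSing}ᶜ with hU
  have hconn : IsPreconnected U :=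
    (countable_preimage_hexSing.isPathConnected_compl_of_one_lt_rank
      one_lt_rank_plane).isConnected.isPreconnected
  have hdense : Dense U := countable_preimage_hexSing.dense_compl ℝ
  let f : Plane → HexSurface := fun x => Φ (toSurface x) - Ψ (toSurface x)
  have hf : Continuous f :=
    (Φ.continuous.comp continuous_toSurface).sub (Ψ.continuous.comp continuous_toSurface)
  have hloc : IsLocallyConstant (U.domRestrict f) := by
    rw [IsLocallyConstant.iff_eventually_eq]
    rintro ⟨x, hx⟩
    have h : ∀ᶠ v in 𝓝 (0 : Plane), f (x + v) = f x := by
      filter_upwards [hΦ.2 x hx, hΨ.2 x hx] with v h1 h2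
      simp only [f, h1, h2, add_sub_add_right_eq_sub]
    have h' : ∀ᶠ y in 𝓝 x, f y = f x := by
      have hsub : Tendsto (fun y => y - x) (𝓝 x) (𝓝 0) := by
        have : Continuous fun y : Plane => y - x := by fun_prop
        simpa using this.tendsto x
      filter_upwards [hsub.eventually h] with y hy
      simpa using hy
    have hval : Tendsto (fun y : U => (y : Plane)) (𝓝 ⟨x, hx⟩) (𝓝 x) :=
      continuous_subtype_val.continuousAt
    exact hval.eventually h'
  have : PreconnectedSpace U := isPreconnected_iff_preconnectedSpace.1 hconn
  obtain ⟨x₀, hx₀⟩ := hdense.nonempty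
  have hconst : ∀ x, f x = f x₀ := by
    have h1 : EqOn f (fun _ => f x₀) U := fun x hx =>
      hloc.apply_eq_of_preconnectedSpace ⟨x, hx⟩ ⟨x₀, hx₀⟩
    exact fun x => congrFun (hf.ext_on hdense continuous_const h1) x
  have hc : f x₀ = 0 := by
    apply eq_zero_of_translate_hexSing
    intro y hy
    rw [← hΨ.1] at hy
    obtain ⟨z, hz, rfl⟩ := hy
    obtain ⟨x, rfl⟩ := toSurface_surjective z
    rw [← hconst x, add_sub_cancel, ← hΦ.1]
    exact mem_image_of_mem _ hz
  ext y
  obtain ⟨x, rfl⟩ := toSurface_surjective y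
  exact sub_eq_zero.1 ((hconst x).trans hc)

/-- The map of the surface induced by a linear symmetry of the lattice. -/
def surfaceMap (g : GL (Fin 2) ℝ) (hg : g ∈ hexStabilizer) : HexSurface → HexSurface :=
  Quotient.map' (planeMap g) fun x y h => by
    rw [QuotientAddGroup.leftRel_apply] at h ⊢
    rw [neg_add_eq_sub, ← planeMap_sub, hg.1, ← neg_add_eq_sub]
    exact h

theorem surfaceMap_toSurface {g : GL (Fin 2) ℝ} (hg : g ∈ hexStabilizer) (x : Plane) :
    surfaceMap g hg (toSurface x) = toSurface (planeMap g x) := rfl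

theorem continuous_surfaceMap {g : GL (Fin 2) ℝ} (hg : g ∈ hexStabilizer) :
    Continuous (surfaceMap g hg) := by
  refine Continuous.quotient_map' ?_ _
  exact continuous_const.matrix_mulVec continuous_id

/-- The homeomorphism of the surface induced by a linear symmetry of the lattice. -/
def surfaceHomeo (g : GL (Fin 2) ℝ) (hg : g ∈ hexStabilizer) : HexSurface ≃ₜ HexSurface where
  toFun := surfaceMap g hg
  invFun := surfaceMap g⁻¹ (inv_mem hg)
  left_inv y := by
    obtain ⟨x, rfl⟩ := toSurface_surjective y
    rw [surfaceMap_toSurface, surfaceMap_toSurface, planeMap_inv_self]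
  right_inv y := by
    obtain ⟨x, rfl⟩ := toSurface_surjective y
    rw [surfaceMap_toSurface, surfaceMap_toSurface, planeMap_self_inv]
  continuous_toFun := continuous_surfaceMap hg
  continuous_invFun := continuous_surfaceMap (inv_mem hg)

theorem surfaceHomeo_toSurface {g : GL (Fin 2) ℝ} (hg : g ∈ hexStabilizer) (x : Plane) :
    surfaceHomeo g hg (toSurface x) = toSurface (planeMap g x) := rfl

theorem isAffineAutomorphism_surfaceHomeo {g : GL (Fin 2) ℝ} (hg : g ∈ hexStabilizer) :
    IsAffineAutomorphism (surfaceHomeo g hg) (g : Matrix (Fin 2) (Fin 2) ℝ) := by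
  refine ⟨?_, fun x _ => Eventually.of_forall fun v => ?_⟩
  · ext y
    obtain ⟨x, rfl⟩ := toSurface_surjective y
    constructor
    · rintro ⟨z, hz, h⟩
      obtain ⟨z, rfl⟩ := toSurface_surjective z
      rw [← h, surfaceHomeo_toSurface, hg.2.1]
      exact hz
    · intro hx
      refine ⟨toSurface (planeMap g⁻¹ x), ((inv_mem hg).2.1 x).2 hx, ?_⟩
      rw [surfaceHomeo_toSurface, planeMap_self_inv]
  · rw [surfaceHomeo_toSurface, surfaceHomeo_toSurface, planeMap_add, toSurface_add]
    rfl

theorem isCuttingSequence_symm_image {τ : ℝ → HexSurface} {v : ℤ → HexLabel}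
    (Ψ : HexSurface ≃ₜ HexSurface) :
    IsCuttingSequence (fun L => Ψ.symm '' hexSide L) τ v ↔
      IsCuttingSequence hexSide (Ψ ∘ τ) v := by
  have h : ∀ L, Ψ.symm '' hexSide L = Ψ ⁻¹' hexSide L := fun L => Ψ.symm.image_eq_preimage_symm _
  unfold IsCuttingSequence
  simp only [h]
  rfl

/-! ### Quadratic forms attached to points of the Teichmüller disk -/

/-- The bilinear form whose kernel, for `z` on the boundary, is the direction `-tan⁻¹ z`. -/
def diskForm (z : UpperHalfPlane) (v v' : Plane) : ℝ :=
  v 0 * v' 0 * Complex.normSq z + (v 0 * v' 1 + v 1 * v' 0) * z.re + v 1 * v' 1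

theorem diskForm_comb (z : UpperHalfPlane) (x y x' y' : ℝ) (e o : Plane) :
    diskForm z (x • e + y • o) (x' • e + y' • o) =
      x * x' * diskForm z e e + y * y' * diskForm z o o + (x * y' + x' * y) * diskForm z e o := by
  simp only [diskForm, Pi.add_apply, Pi.smul_apply, smul_eq_mul]
  ring

theorem diskForm_self_pos (z : UpperHalfPlane) {v : Plane} (hv : v ≠ 0) : 0 < diskForm z v v := by
  have hz := z.im_pos
  have h : diskForm z v v = (v 0 * z.re + v 1) ^ 2 + (v 0 * z.im) ^ 2 := by
    simp only [diskForm, Complex.normSq_apply, UpperHalfPlane.coe_re, UpperHalfPlane.coe_im]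
    ring
  rw [h]
  by_cases h0 : v 0 = 0
  · have h1 : v 1 ≠ 0 := fun h1 => hv (by ext i; fin_cases i <;> simp [h0, h1])
    rw [h0]
    have := pow_pos (abs_pos.2 h1) 2
    rw [sq_abs] at this
    nlinarith
  · have := pow_pos (abs_pos.2 (mul_ne_zero h0 hz.ne')) 2
    rw [sq_abs] at this
    nlinarith [sq_nonneg (v 0 * z.re + v 1)]

theorem normSq_sigma (g : GL (Fin 2) ℝ) (z : ℂ) :
    Complex.normSq (UpperHalfPlane.σ g z) = Complex.normSq z := by
  unfold UpperHalfPlane.σ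
  split_ifs <;> simp [Complex.normSq_conj]

/-- Up to scale the form at the point of g · S_E is ⟨g v, g v'⟩, so right multiplication by h
substitutes h v and h v'. The scale is the inverse squared norm of the denominator of the Möbius
map. -/
theorem exists_diskForm_rightAct (z : UpperHalfPlane) (h : GL (Fin 2) ℝ) :
    ∃ c : ℝ, 0 < c ∧ ∀ v v',
      diskForm (rightAct z h) v v' = c * diskForm z (planeMap h v) (planeMap h v') := by
  unfold rightAct
  set g : GL (Fin 2) ℝ := Matrix.GeneralLinearGroup.mkOfDetNeZero
    (Matrix.transpose (h : Matrix (Fin 2) (Fin 2) ℝ)) _ with hg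
  have hgij : ∀ i j, g i j = h j i := fun i j => rfl
  have hD : 0 < Complex.normSq (UpperHalfPlane.denom g z) :=
    UpperHalfPlane.normSq_denom_pos g z.im_ne_zero
  refine ⟨(Complex.normSq (UpperHalfPlane.denom g z))⁻¹, inv_pos.2 hD, fun v v' => ?_⟩
  rw [eq_inv_mul_iff_mul_eq₀ hD.ne', diskForm, UpperHalfPlane.coe_smul, normSq_sigma,
    Complex.normSq_div, UpperHalfPlane.re_smul, Complex.div_re]
  field_simp
  simp only [diskForm, Complex.normSq_apply, UpperHalfPlane.num, UpperHalfPlane.denom, hgij,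
    planeMap, Matrix.mulVec, dotProduct, Fin.sum_univ_two, Complex.add_re, Complex.add_im,
    Complex.mul_re, Complex.mul_im, Complex.ofReal_re, Complex.ofReal_im, UpperHalfPlane.coe_re,
    UpperHalfPlane.coe_im]
  ring

theorem rightAct_mul (z : UpperHalfPlane) (g h : GL (Fin 2) ℝ) :
    rightAct (rightAct z g) h = rightAct z (g * h) := by
  unfold rightAct
  rw [smul_smul]
  congr 1
  apply Units.ext
  change (h : Matrix (Fin 2) (Fin 2) ℝ).transpose * (g : Matrix (Fin 2) (Fin 2) ℝ).transpose =
    ((g * h : GL (Fin 2) ℝ) : Matrix (Fin 2) (Fin 2) ℝ).transpose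
  rw [Units.val_mul, Matrix.transpose_mul]

theorem rightAct_one (z : UpperHalfPlane) : rightAct z 1 = z := by
  unfold rightAct
  convert one_smul (GL (Fin 2) ℝ) z
  apply Units.ext
  change ((1 : GL (Fin 2) ℝ) : Matrix (Fin 2) (Fin 2) ℝ).transpose = 1
  simp

/-! ### The sides of the tessellation -/

/-- The first vector of the lattice basis. -/
def basisE : Plane := ![1, 0]

/-- The second vector of the lattice basis. -/
def basisO : Plane := ![3 / 2, √3 / 2]

theorem coordA_basisE : coordA basisE = 1 := by simp [coordA, basisE]
theorem coordB_basisE : coordB basisE = 0 := by simp [coordB, basisE]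
theorem coordA_basisO : coordA basisO = 0 := by
  have := sqrt_three_mul_self
  simp [coordA, basisO]; linarith
theorem coordB_basisO : coordB basisO = 1 := by
  have := sqrt_three_mul_self
  simp [coordB, basisO]; linarith

/-- The vectors that bound the `i`-th sector, one orbit. -/
def sectorE (i : Fin 6) : Plane := planeMap (nu i)⁻¹ basisE

/-- The vectors that bound the `i`-th sector, the other orbit. -/
def sectorO (i : Fin 6) : Plane := planeMap (nu i)⁻¹ basisO

theorem planeMap_ne_zero (g : GL (Fin 2) ℝ) {v : Plane} (hv : v ≠ 0) : planeMap g v ≠ 0 := by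
  intro h
  apply hv
  rw [← planeMap_inv_self g v, h, planeMap_zero]

theorem sectorE_ne_zero (i : Fin 6) : sectorE i ≠ 0 :=
  planeMap_ne_zero _ fun h => by simpa [h] using coordA_basisE

theorem sectorO_ne_zero (i : Fin 6) : sectorO i ≠ 0 :=
  planeMap_ne_zero _ fun h => by simpa [h] using coordB_basisO

theorem eq_sector_comb (m : Fin 6) (v : Plane) :
    v = coordA (planeMap (nu m) v) • sectorE m + coordB (planeMap (nu m) v) • sectorO m := by
  rw [sectorE, sectorO, ← planeMap_smul, ← planeMap_smul, ← planeMap_add]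
  have h : coordA (planeMap (nu m) v) • basisE + coordB (planeMap (nu m) v) • basisO =
      planeMap (nu m) v := by
    apply plane_ext_coord <;>
      simp [coordA_basisE, coordB_basisE, coordA_basisO, coordB_basisO]
  rw [h, planeMap_inv_self]

/-- The vectors bounding a sector lie in no open sector; with `sectorForm_sectorO_nonpos` this
starts the ping-pong. -/
theorem sectorForm_sectorE_nonpos (m i : Fin 6) : sectorForm m (sectorE i) ≤ 0 := by
  have h : sectorForm i (sectorE i) = 0 := by
    rw [sectorForm, sectorE, planeMap_self_inv, coordB_basisE, mul_zero]
  rcases eq_or_ne i m with rfl | hne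
  · exact h.le
  · exact sectorForm_nonpos hne h.ge

theorem sectorForm_sectorO_nonpos (m i : Fin 6) : sectorForm m (sectorO i) ≤ 0 := by
  have h : sectorForm i (sectorO i) = 0 := by
    rw [sectorForm, sectorO, planeMap_self_inv, coordA_basisO, zero_mul]
  rcases eq_or_ne i m with rfl | hne
  · exact h.le
  · exact sectorForm_nonpos hne h.ge

/-- A function of `z` that vanishes exactly on the side `E_i` and is positive at `i`. -/
def sideForm (i : Fin 6) (z : UpperHalfPlane) : ℝ := diskForm z (sectorE i) (sectorO i)

/-- A geodesic is the locus where the two vectors that define its end points are orthogonal for the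
form. -/
theorem mem_baseSide_iff (z : UpperHalfPlane) : z ∈ baseSide ↔ diskForm z basisE basisO = 0 := by
  have h3 := sqrt_three_mul_self
  have hpos : (0 : ℝ) < √3 := by positivity
  have hc : (1 / (2 * √3) : ℝ) = √3 / 6 := by field_simp; linarith
  change ‖(z : ℂ) + (1 / (2 * √3) : ℝ)‖ = 1 / (2 * √3) ↔ _
  rw [hc, ← sq_eq_sq₀ (norm_nonneg _) (by positivity), ← Complex.normSq_eq_norm_sq,
    Complex.normSq_apply, diskForm, Complex.normSq_apply]
  simp [basisE, basisO]
  constructor <;> intro h <;> nlinarith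

theorem diskForm_rightAct_eq_zero_iff (z : UpperHalfPlane) (h : GL (Fin 2) ℝ) (v v' : Plane) :
    diskForm (rightAct z h) v v' = 0 ↔ diskForm z (planeMap h v) (planeMap h v') = 0 := by
  obtain ⟨c, hc, h⟩ := exists_diskForm_rightAct z h
  rw [h, mul_eq_zero, or_iff_right hc.ne']

theorem diskForm_rightAct_pos_iff (z : UpperHalfPlane) (h : GL (Fin 2) ℝ) (v v' : Plane) :
    0 < diskForm (rightAct z h) v v' ↔ 0 < diskForm z (planeMap h v) (planeMap h v') := by
  obtain ⟨c, hc, h⟩ := exists_diskForm_rightAct z h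
  rw [h, mul_pos_iff_of_pos_left hc]

/-- Moving a side by a group element amounts to moving its pair of vectors by the inverse, so that
questions about the tessellation become questions about vectors in the plane. -/
theorem mem_tessellationSides_iff (z : UpperHalfPlane) (i : Fin 6) :
    z ∈ tessellationSides i ↔ ∃ g ∈ hexReflectionGroup,
      diskForm z (planeMap g (sectorE i)) (planeMap g (sectorO i)) = 0 := by
  have key : ∀ x g, rightAct (rightAct x (nu i)) g = z ↔ x = rightAct z (g⁻¹ * (nu i)⁻¹) := by
    intro x g
    constructor
    · rintro rfl
      rw [rightAct_mul, rightAct_mul]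
      simp [rightAct_one]
    · rintro rfl
      rw [rightAct_mul, rightAct_mul]
      simp [rightAct_one]
  constructor
  · rintro ⟨g, hg, _, ⟨x, hx, rfl⟩, h⟩
    obtain rfl := (key x g).1 h
    refine ⟨g⁻¹, inv_mem hg, ?_⟩
    rwa [mem_baseSide_iff, diskForm_rightAct_eq_zero_iff, planeMap_mul, planeMap_mul] at hx
  · rintro ⟨g, hg, h⟩
    refine ⟨g⁻¹, inv_mem hg, _, ⟨rightAct z (g⁻¹⁻¹ * (nu i)⁻¹), ?_, rfl⟩, (key _ _).2 rfl⟩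
    rw [mem_baseSide_iff, diskForm_rightAct_eq_zero_iff, planeMap_mul, planeMap_mul, inv_inv]
    exact h

theorem rightAct_mem_tessellationSides_iff {z : UpperHalfPlane} {i : Fin 6} {h : GL (Fin 2) ℝ}
    (hh : h ∈ hexReflectionGroup) :
    rightAct z h ∈ tessellationSides i ↔ z ∈ tessellationSides i := by
  have key : ∀ z h, h ∈ hexReflectionGroup → rightAct z h ∈ tessellationSides i →
      z ∈ tessellationSides i := by
    intro z h hh hz
    rw [mem_tessellationSides_iff] at hz ⊢
    obtain ⟨g, hg, h0⟩ := hz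
    rw [diskForm_rightAct_eq_zero_iff, ← planeMap_mul, ← planeMap_mul] at h0
    exact ⟨h * g, mul_mem hh hg, h0⟩
  refine ⟨key z h hh, fun hz => key (rightAct z h) h⁻¹ (inv_mem hh) ?_⟩
  rwa [rightAct_mul, mul_inv_cancel, rightAct_one]

/-! ### Reduced words in the reflection group -/

theorem gammaConj_inv (i : Fin 6) : (gammaConj i)⁻¹ = gammaConj i :=
  inv_eq_of_mul_eq_one_left (gammaConj_mul_self i)

/-- The generators are involutions, so multiplying a reduced word by a generator on the left either
lengthens it or cancels its first letter. -/
theorem exists_reduced_word {g : GL (Fin 2) ℝ} (hg : g ∈ hexReflectionGroup) :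
    ∃ l : List (Fin 6), l.IsChain (· ≠ ·) ∧ (l.map gammaConj).prod = g := by
  have hcons : ∀ (m : Fin 6) (g : GL (Fin 2) ℝ),
      (∃ l : List (Fin 6), l.IsChain (· ≠ ·) ∧ (l.map gammaConj).prod = g) →
      ∃ l : List (Fin 6), l.IsChain (· ≠ ·) ∧ (l.map gammaConj).prod = gammaConj m * g := by
    rintro m _ ⟨l, hl, rfl⟩
    cases l with
    | nil => exact ⟨[m], by simp, by simp⟩
    | cons a l =>
      by_cases hma : m = a
      · subst hma
        refine ⟨l, (List.isChain_cons.1 hl).2, ?_⟩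
        rw [List.map_cons, List.prod_cons, ← mul_assoc, gammaConj_mul_self, one_mul]
      · exact ⟨m :: a :: l, List.isChain_cons_cons.2 ⟨hma, hl⟩, by simp⟩
  induction hg using Subgroup.closure_induction_left with
  | one => exact ⟨[], by simp, by simp⟩
  | mul_left x hx y _ ih =>
    obtain ⟨m, rfl⟩ := hx
    exact hcons m y ih
  | inv_mul_cancel x hx y _ ih =>
    obtain ⟨m, rfl⟩ := hx
    rw [gammaConj_inv]
    exact hcons m y ih

/-- A reduced word with first letter `m` carries the complement of all sectors to sector `m`. -/
theorem sectorForm_word_nonneg {v : Plane} (hv : ∀ j, sectorForm j v ≤ 0) (m : Fin 6)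
    (l : List (Fin 6)) (hl : (m :: l).IsChain (· ≠ ·)) :
    0 ≤ sectorForm m (planeMap ((m :: l).map gammaConj).prod v) := by
  induction l generalizing m with
  | nil => simpa [sectorForm_gammaConj] using hv m
  | cons a l ih =>
    obtain ⟨hma, hl⟩ := List.isChain_cons_cons.1 hl
    rw [List.map_cons, List.prod_cons, planeMap_mul, sectorForm_gammaConj, neg_nonneg]
    exact sectorForm_nonpos (Ne.symm hma) (ih a hl)

/-- Up to sign both vectors have nonnegative coordinates in the basis `sectorE m`, `sectorO m`.
There all entries of the Gram matrix are positive: the diagonal ones always, the other by `0 <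
sideForm m z`. -/
theorem diskForm_ne_zero_of_sector {z : UpperHalfPlane} {m : Fin 6} (hz : 0 < sideForm m z)
    {v v' : Plane} (hv0 : v ≠ 0) (hv0' : v' ≠ 0) (hv : 0 ≤ sectorForm m v)
    (hv' : 0 ≤ sectorForm m v') : diskForm z v v' ≠ 0 := by
  have hP := diskForm_self_pos z (sectorE_ne_zero m)
  have hS := diskForm_self_pos z (sectorO_ne_zero m)
  have e := eq_sector_comb m v
  have e' := eq_sector_comb m v'
  unfold sectorForm at hv hv'
  unfold sideForm at hz
  generalize coordA (planeMap (nu m) v) = x at *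
  generalize coordB (planeMap (nu m) v) = y at *
  generalize coordA (planeMap (nu m) v') = x' at *
  generalize coordB (planeMap (nu m) v') = y' at *
  have hxy : ¬ (x = 0 ∧ y = 0) := fun h => hv0 (by rw [e, h.1, h.2]; simp)
  have hxy' : ¬ (x' = 0 ∧ y' = 0) := fun h => hv0' (by rw [e', h.1, h.2]; simp)
  rw [e, e', diskForm_comb]
  generalize diskForm z (sectorE m) (sectorE m) = P at *
  generalize diskForm z (sectorO m) (sectorO m) = S at *
  generalize diskForm z (sectorE m) (sectorO m) = R at *
  have key : ∀ {x y x' y' : ℝ}, 0 ≤ x → 0 ≤ y → 0 ≤ x' → 0 ≤ y' → ¬ (x = 0 ∧ y = 0) →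
      ¬ (x' = 0 ∧ y' = 0) → 0 < x * x' * P + y * y' * S + (x * y' + x' * y) * R := by
    intro x y x' y' hx hy hx' hy' h h'
    have h1 := mul_nonneg (mul_nonneg hx hx') hP.le
    have h2 := mul_nonneg (mul_nonneg hy hy') hS.le
    have h3 := mul_nonneg (mul_nonneg hx hy') hz.le
    have h4 := mul_nonneg (mul_nonneg hx' hy) hz.le
    rcases hx.eq_or_lt with rfl | hx <;> rcases hx'.eq_or_lt with rfl | hx'
    · have hy := hy.lt_of_ne fun h0 => h ⟨rfl, h0.symm⟩
      have hy' := hy'.lt_of_ne fun h0 => h' ⟨rfl, h0.symm⟩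
      nlinarith [mul_pos (mul_pos hy hy') hS]
    · have hy := hy.lt_of_ne fun h0 => h ⟨rfl, h0.symm⟩
      nlinarith [mul_pos (mul_pos hx' hy) hz]
    · have hy' := hy'.lt_of_ne fun h0 => h' ⟨rfl, h0.symm⟩
      nlinarith [mul_pos (mul_pos hx hy') hz]
    · nlinarith [mul_pos (mul_pos hx hx') hP]
  have hsign : ∀ {x y : ℝ}, 0 ≤ x * y → (0 ≤ x ∧ 0 ≤ y) ∨ (0 ≤ -x ∧ 0 ≤ -y) := by
    intro x y h
    rcases mul_nonneg_iff.1 h with h | h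
    · exact Or.inl h
    · exact Or.inr ⟨neg_nonneg.2 h.1, neg_nonneg.2 h.2⟩
  have hn : ∀ {x y : ℝ}, ¬ (x = 0 ∧ y = 0) → ¬ (-x = 0 ∧ -y = 0) := fun h h' =>
    h ⟨neg_eq_zero.1 h'.1, neg_eq_zero.1 h'.2⟩
  rcases hsign hv with h | h <;> rcases hsign hv' with h' | h'
  · exact (key h.1 h.2 h'.1 h'.2 hxy hxy').ne'
  · have := key h.1 h.2 h'.1 h'.2 hxy (hn hxy')
    intro h0
    linarith
  · have := key h.1 h.2 h'.1 h'.2 (hn hxy) hxy'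
    intro h0
    linarith
  · have := key h.1 h.2 h'.1 h'.2 (hn hxy) (hn hxy')
    intro h0
    linarith

/-- The reflection in a side fixes the points of this side. -/
theorem diskForm_gammaConj {z : UpperHalfPlane} {m : Fin 6} (hz : sideForm m z = 0)
    (v v' : Plane) :
    diskForm z (planeMap (gammaConj m) v) (planeMap (gammaConj m) v') = diskForm z v v' := by
  unfold sideForm at hz
  have e : ∀ v, planeMap (gammaConj m) v = (-coordA (planeMap (nu m) v)) • sectorE m +
      coordB (planeMap (nu m) v) • sectorO m := fun v => by
    conv_lhs => rw [eq_sector_comb m (planeMap (gammaConj m) v)]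
    rw [nu_gammaConj, coordA_veechGamma, coordB_veechGamma]
  conv_rhs => rw [eq_sector_comb m v, eq_sector_comb m v']
  rw [e, e, diskForm_comb, diskForm_comb, hz]
  ring

/-- Ping-pong: a nonempty reduced word with first letter m sends both vectors bounding sector i into
the closed sector m, where no two nonzero vectors are orthogonal at a point of the open hexagon. -/
theorem not_mem_tessellationSides_of_pos {z : UpperHalfPlane} (hz : ∀ i, 0 < sideForm i z)
    (i : Fin 6) : z ∉ tessellationSides i := by
  rw [mem_tessellationSides_iff]
  rintro ⟨g, hg, h⟩
  obtain ⟨l, hl, rfl⟩ := exists_reduced_word hg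
  cases l with
  | nil => exact (hz i).ne' (by simpa [sideForm] using h)
  | cons m l =>
    exact diskForm_ne_zero_of_sector (hz m) (planeMap_ne_zero _ (sectorE_ne_zero i))
      (planeMap_ne_zero _ (sectorO_ne_zero i))
      (sectorForm_word_nonneg (fun j => sectorForm_sectorE_nonpos j i) m l hl)
      (sectorForm_word_nonneg (fun j => sectorForm_sectorO_nonpos j i) m l hl) h

/-- The same ping-pong works at a point of the side E_s: a first letter s can be removed because γ_s
preserves the form there, and the next letter differs from s. -/
theorem eq_of_mem_tessellationSides {z : UpperHalfPlane} {s : Fin 6} (hs : sideForm s z = 0)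
    (hz : ∀ i, i ≠ s → 0 < sideForm i z) {i : Fin 6} (h : z ∈ tessellationSides i) : i = s := by
  rw [mem_tessellationSides_iff] at h
  obtain ⟨g, hg, h⟩ := h
  obtain ⟨l, hl, rfl⟩ := exists_reduced_word hg
  have key : ∀ l : List (Fin 6), l.IsChain (· ≠ ·) → (∀ m ∈ l.head?, m ≠ s) →
      diskForm z (planeMap (l.map gammaConj).prod (sectorE i))
        (planeMap (l.map gammaConj).prod (sectorO i)) = 0 → i = s := by
    intro l hl hhead h
    by_contra hne
    cases l with
    | nil => exact (hz i hne).ne' (by simpa [sideForm] using h)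
    | cons m l =>
      exact diskForm_ne_zero_of_sector (hz m (hhead m rfl))
        (planeMap_ne_zero _ (sectorE_ne_zero i)) (planeMap_ne_zero _ (sectorO_ne_zero i))
        (sectorForm_word_nonneg (fun j => sectorForm_sectorE_nonpos j i) m l hl)
        (sectorForm_word_nonneg (fun j => sectorForm_sectorO_nonpos j i) m l hl) h
  cases l with
  | nil => exact key [] hl (by simp) h
  | cons m l =>
    by_cases hm : m = s
    · subst hm
      rw [List.map_cons, List.prod_cons, planeMap_mul, planeMap_mul, diskForm_gammaConj hs] at h
      exact key l (List.isChain_cons.1 hl).2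
        (fun a ha => Ne.symm ((List.isChain_cons.1 hl).1 a ha)) h
    · exact key (m :: l) hl (by simpa using hm) h

/-! ### The crossings of a Teichmüller ray -/

/-- The unit vector of direction `θ`. -/
def direction (θ : ℝ) : Plane := ![Real.cos θ, Real.sin θ]

/-- The dot product of the plane. -/
def dot (x y : Plane) : ℝ := x 0 * y 0 + x 1 * y 1

/-- The determinant of two vectors of the plane. -/
def wedge (x y : Plane) : ℝ := x 0 * y 1 - x 1 * y 0

theorem planeMap_rotationGL (a : ℝ) (x : Plane) : planeMap (rotationGL a) x =
    ![Real.cos a * x 0 - Real.sin a * x 1, Real.sin a * x 0 + Real.cos a * x 1] := by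
  change Matrix.mulVec !![Real.cos a, -Real.sin a; Real.sin a, Real.cos a] x = _
  ext i
  fin_cases i
  · simp [Matrix.mulVec, dotProduct, Fin.sum_univ_two]; ring
  · simp [Matrix.mulVec, dotProduct, Fin.sum_univ_two]

theorem planeMap_teichFlow (t : ℝ) (x : Plane) : planeMap (teichFlow t) x =
    ![Real.exp (t / 2) * x 0, Real.exp (-(t / 2)) * x 1] := by
  change Matrix.mulVec !![Real.exp (t / 2), 0; 0, Real.exp (-(t / 2))] x = _
  ext i
  fin_cases i <;> simp [Matrix.mulVec, dotProduct, Fin.sum_univ_two]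

theorem dot_rotationGL (a : ℝ) (x y : Plane) :
    dot (planeMap (rotationGL a) x) (planeMap (rotationGL a) y) = dot x y := by
  rw [planeMap_rotationGL, planeMap_rotationGL]
  simp only [dot, Matrix.cons_val_zero, Matrix.cons_val_one]
  linear_combination (x 0 * y 0 + x 1 * y 1) * Real.sin_sq_add_cos_sq a

theorem dot_rotationGL_inv (a : ℝ) (x y : Plane) :
    dot (planeMap (rotationGL a)⁻¹ x) (planeMap (rotationGL a)⁻¹ y) = dot x y := by
  rw [← dot_rotationGL a, planeMap_self_inv, planeMap_self_inv]

/-- At the centre the form is the dot product. The flow contracts the component along θ and expands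
the orthogonal one, and the outer rotation disappears because it is an isometry. -/
theorem exists_diskForm_teichRay (θ t : ℝ) : ∃ c : ℝ, 0 < c ∧ ∀ v v',
    diskForm (teichRay θ t) v v' =
      c * (Real.exp (-t) * (dot (direction θ) v * dot (direction θ) v') +
        Real.exp t * (wedge (direction θ) v * wedge (direction θ) v')) := by
  obtain ⟨c, hc, h⟩ := exists_diskForm_rightAct UpperHalfPlane.I (teichFlowDir θ t)
  refine ⟨c, hc, fun v v' => ?_⟩
  have hI : ∀ v v' : Plane, diskForm UpperHalfPlane.I v v' = dot v v' := by
    intro v v'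
    simp [diskForm, dot, UpperHalfPlane.I_re]
  rw [teichRay, teichPoint, h, hI, teichFlowDir, planeMap_mul, planeMap_mul, planeMap_mul,
    planeMap_mul, dot_rotationGL_inv, planeMap_teichFlow, planeMap_teichFlow, planeMap_rotationGL,
    planeMap_rotationGL]
  have h1 : Real.exp t = Real.exp (t / 2) * Real.exp (t / 2) := by
    rw [← Real.exp_add]; congr 1; ring
  have h2 : Real.exp (-t) = Real.exp (-(t / 2)) * Real.exp (-(t / 2)) := by
    rw [← Real.exp_add]; congr 1; ring
  rw [h1, h2, Real.cos_pi_div_two_sub, Real.sin_pi_div_two_sub]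
  simp only [dot, wedge, direction, Matrix.cons_val_zero, Matrix.cons_val_one]
  ring

/-- The value at time `t` of the `i`-th side of the ideal hexagon moved by `g`, up to a positive
factor. -/
def rayForm (θ : ℝ) (g : GL (Fin 2) ℝ) (i : Fin 6) (t : ℝ) : ℝ :=
  sideForm i (rightAct (teichRay θ t) g⁻¹)

theorem wedge_planeMap (g : GL (Fin 2) ℝ) (x y : Plane) : wedge (planeMap g x) (planeMap g y) =
    (g : Matrix (Fin 2) (Fin 2) ℝ).det * wedge x y := by
  simp only [wedge, planeMap, Matrix.mulVec, dotProduct, Fin.sum_univ_two, Matrix.det_fin_two]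
  ring

/-- For u = a E + b O in the sector basis, both wedges are multiples of √3/2, the area of the basis,
which gives the factor 3/4. The sign of the determinant does not matter, since it enters squared. -/
theorem wedge_sector {g : GL (Fin 2) ℝ} (hg : g ∈ hexStabilizer) (i : Fin 6) (u : Plane) :
    wedge u (planeMap g⁻¹ (sectorE i)) * wedge u (planeMap g⁻¹ (sectorO i)) =
      -(3 / 4) * sectorForm i (planeMap g u) := by
  have hd := (mul_mem (nu_mem_hexStabilizer i) hg).2.2
  have h1 := wedge_planeMap (nu i * g) u (planeMap g⁻¹ (sectorE i))
  have h2 := wedge_planeMap (nu i * g) u (planeMap g⁻¹ (sectorO i))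
  rw [planeMap_mul, planeMap_mul, planeMap_self_inv, sectorE, planeMap_self_inv] at h1
  rw [planeMap_mul, planeMap_mul, planeMap_self_inv, sectorO, planeMap_self_inv] at h2
  have h3 : wedge (planeMap (nu i) (planeMap g u)) basisE *
      wedge (planeMap (nu i) (planeMap g u)) basisO = -(3 / 4) * sectorForm i (planeMap g u) := by
    have := sqrt_three_mul_self
    simp only [sectorForm, wedge, basisE, basisO, coordA, coordB, Matrix.cons_val_zero,
      Matrix.cons_val_one]
    grind
  rw [← h3, h1, h2, sectorE, sectorO]
  linear_combination (-(wedge u (planeMap g⁻¹ (planeMap (nu i)⁻¹ basisE)) *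
    wedge u (planeMap g⁻¹ (planeMap (nu i)⁻¹ basisO)))) * hd

theorem exists_rayForm (θ : ℝ) {g : GL (Fin 2) ℝ} (hg : g ∈ hexStabilizer) (i : Fin 6) :
    ∃ X : ℝ, ∀ t, ∃ c, 0 < c ∧ rayForm θ g i t =
      c * (X - Real.exp (2 * t) * sectorForm i (planeMap g (direction θ))) := by
  refine ⟨4 / 3 * (dot (direction θ) (planeMap g⁻¹ (sectorE i)) *
    dot (direction θ) (planeMap g⁻¹ (sectorO i))), fun t => ?_⟩
  obtain ⟨c, hc, h⟩ := exists_diskForm_rightAct (teichRay θ t) g⁻¹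
  obtain ⟨c', hc', h'⟩ := exists_diskForm_teichRay θ t
  refine ⟨3 / 4 * c * c' * Real.exp (-t), by positivity, ?_⟩
  rw [rayForm, sideForm, h, h', wedge_sector hg]
  have h1 : Real.exp t = Real.exp (-t) * Real.exp (2 * t) := by
    rw [← Real.exp_add]; congr 1; ring
  rw [h1]
  ring

theorem mem_tessellationSides_of_rayForm_eq_zero {θ t : ℝ} {g : GL (Fin 2) ℝ}
    (hg : g ∈ hexReflectionGroup) {i : Fin 6} (h : rayForm θ g i t = 0) :
    teichRay θ t ∈ tessellationSides i := by
  rw [← rightAct_mem_tessellationSides_iff (inv_mem hg), mem_tessellationSides_iff]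
  exact ⟨1, one_mem _, by simpa [rayForm, sideForm] using h⟩

theorem hexReflectionGroup_le : hexReflectionGroup ≤ hexStabilizer := by
  rw [hexReflectionGroup, Subgroup.closure_le]
  rintro _ ⟨i, rfl⟩
  exact gammaConj_mem_hexStabilizer i

/-- At time `T` the ray of direction `θ` is in the ideal hexagon moved by `g`, possibly on a side
from which it moves inwards. -/
def EntersHexagon (θ : ℝ) (g : GL (Fin 2) ℝ) (T : ℝ) : Prop :=
  ∀ i, 0 < rayForm θ g i T ∨ rayForm θ g i T = 0 ∧ sectorForm i (planeMap g (direction θ)) < 0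

theorem rayForm_one_pos (θ : ℝ) (i : Fin 6) : 0 < rayForm θ 1 i 0 := by
  have h0 : teichRay θ 0 = UpperHalfPlane.I := by
    have : teichFlow 0 = 1 := by
      apply Units.ext
      change !![Real.exp (0 / 2), 0; 0, Real.exp (-(0 / 2))] = (1 : Matrix (Fin 2) (Fin 2) ℝ)
      simp [Matrix.one_fin_two]
    rw [teichRay, teichPoint, teichFlowDir, this, mul_one, inv_mul_cancel, rightAct_one]
  rw [rayForm, h0, inv_one, rightAct_one, sideForm, sectorE, sectorO]
  have hdiag : ∀ v v' : Plane, diskForm UpperHalfPlane.I v v' = dot v v' := fun v v' => by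
    simp [diskForm, dot, UpperHalfPlane.I_re]
  have hnu : ∀ v v' : Plane, dot (planeMap (nu i) v) (planeMap (nu i) v') = dot v v' := by
    intro v v'
    have := sqrt_three_mul_self
    simp only [planeMap_nu, dot]
    fin_cases i <;> simp [nuMatrix, Matrix.mulVec, dotProduct, Fin.sum_univ_two] <;> grind
  rw [hdiag, ← hnu, planeMap_self_inv, planeMap_self_inv]
  simp [dot, basisE, basisO]

theorem entersHexagon_zero (θ : ℝ) : EntersHexagon θ 1 0 := fun i => Or.inl (rayForm_one_pos θ i)

theorem not_mem_tessellationSides_of_rayForm_pos {θ t : ℝ} {g : GL (Fin 2) ℝ}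
    (hg : g ∈ hexReflectionGroup) (h : ∀ i, 0 < rayForm θ g i t) (i : Fin 6) :
    teichRay θ t ∉ tessellationSides i := by
  rw [← rightAct_mem_tessellationSides_iff (inv_mem hg)]
  exact not_mem_tessellationSides_of_pos h i

namespace EntersHexagon

variable {θ T : ℝ} {g : GL (Fin 2) ℝ} (hT : EntersHexagon θ g T)
include hT

/-- If the direction is not in the open sector i, the quantity X - e^{2t} f_i never decreases; if
the ray starts on the side, the strict sign in `EntersHexagon` makes it increase. -/
theorem rayForm_pos (hg : g ∈ hexStabilizer) {i : Fin 6}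
    (hi : sectorForm i (planeMap g (direction θ)) ≤ 0) {t : ℝ} (ht : T < t) :
    0 < rayForm θ g i t := by
  obtain ⟨X, hX⟩ := exists_rayForm θ hg i
  obtain ⟨c, hc, h⟩ := hX T
  obtain ⟨c', hc', h'⟩ := hX t
  have he : Real.exp (2 * T) < Real.exp (2 * t) := Real.exp_lt_exp.2 (by linarith)
  have hE := Real.exp_pos (2 * T)
  rw [h']
  refine mul_pos hc' ?_
  rcases hT i with h1 | ⟨h1, h2⟩
  · rw [h, mul_pos_iff_of_pos_left hc] at h1
    nlinarith
  · rw [h, mul_eq_zero, or_iff_right hc.ne'] at h1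
    nlinarith

/-- The exit of the ray from an ideal hexagon. -/
theorem exists_exit (hg : g ∈ hexReflectionGroup) {m : Fin 6}
    (hm : 0 < sectorForm m (planeMap g (direction θ))) :
    ∃ T', T < T' ∧ teichRay θ T' ∈ tessellationSides m ∧
      (∀ i, teichRay θ T' ∈ tessellationSides i → i = m) ∧
      (∀ t, T < t → t < T' → ∀ i, teichRay θ t ∉ tessellationSides i) ∧
      EntersHexagon θ (gammaConj m * g) T' := by
  have hgS := hexReflectionGroup_le hg
  have hneg : ∀ i, i ≠ m → sectorForm i (planeMap g (direction θ)) < 0 := fun i hi =>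
    sectorForm_neg hi.symm hm
  obtain ⟨X, hX⟩ := exists_rayForm θ hgS m
  set Y := sectorForm m (planeMap g (direction θ)) with hY
  have hXpos : Real.exp (2 * T) * Y < X := by
    obtain ⟨c, hc, h⟩ := hX T
    rcases hT m with h1 | ⟨-, h1⟩
    · rw [h, mul_pos_iff_of_pos_left hc] at h1
      linarith
    · linarith
  have hX0 : 0 < X := lt_trans (mul_pos (Real.exp_pos _) hm) hXpos
  -- The crossing time solves e^{2t} Y = X.
  have hexp : Real.exp (2 * (Real.log (X / Y) / 2)) = X / Y := by
    rw [mul_div_cancel₀ _ (two_ne_zero), Real.exp_log (div_pos hX0 hm)]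
  set T' := Real.log (X / Y) / 2 with hT'
  have hTT' : T < T' := by
    have : Real.exp (2 * T) < Real.exp (2 * T') := by rw [hexp]; exact (lt_div_iff₀ hm).2 hXpos
    have := Real.exp_lt_exp.1 this
    linarith
  have hzero : rayForm θ g m T' = 0 := by
    obtain ⟨c, hc, h⟩ := hX T'
    rw [h, hexp, div_mul_cancel₀ _ hm.ne', sub_self, mul_zero]
  have hpos : ∀ i, i ≠ m → 0 < rayForm θ g i T' := fun i hi =>
    hT.rayForm_pos hgS (hneg i hi).le hTT'
  refine ⟨T', hTT', mem_tessellationSides_of_rayForm_eq_zero hg hzero, fun i hi => ?_,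
    fun t h1 h2 => ?_, fun i => ?_⟩
  · rw [← rightAct_mem_tessellationSides_iff (inv_mem hg)] at hi
    exact eq_of_mem_tessellationSides hzero hpos hi
  · refine not_mem_tessellationSides_of_rayForm_pos hg fun i => ?_
    rcases eq_or_ne i m with rfl | hi
    · obtain ⟨c, hc, h⟩ := hX t
      rw [h]
      refine mul_pos hc ?_
      have : Real.exp (2 * t) < Real.exp (2 * T') := Real.exp_lt_exp.2 (by linarith)
      rw [hexp, lt_div_iff₀ hm] at this
      linarith
    · exact hT.rayForm_pos hgS (hneg i hi).le h1
  -- The crossing point is fixed by the reflection in the side, so the form there is unchanged and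
  -- the six signs carry over to the next hexagon. The sign of `sectorForm m` is reversed, so the
  -- ray now moves away from this side into it.
  · have hinv : rightAct (teichRay θ T') (gammaConj m * g)⁻¹ =
        rightAct (rightAct (teichRay θ T') g⁻¹) (gammaConj m) := by
      rw [rightAct_mul, mul_inv_rev, gammaConj_inv]
    rcases eq_or_ne i m with rfl | hi
    · right
      constructor
      · rw [rayForm, hinv, sideForm, diskForm_rightAct_eq_zero_iff, diskForm_gammaConj hzero]
        exact hzero
      · rw [planeMap_mul, sectorForm_gammaConj]
        linarith
    · left
      rw [rayForm, hinv, sideForm, diskForm_rightAct_pos_iff, diskForm_gammaConj hzero]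
      exact hpos i hi

end EntersHexagon

/-- The first `k` labels of the Teichmüller cutting sequence are the sectors of the successive
images of the direction. -/
theorem IsTeichCuttingPrefix.sectorForm_pos {θ : ℝ} {s : ℕ → Fin 6} {k : ℕ}
    (h : IsTeichCuttingPrefix θ s k) (j : ℕ) (hj : j < k) :
    0 < sectorForm (s j) (planeMap (gammaProd s j) (direction θ)) := by
  obtain ⟨t, hmono, hcross, hfirst⟩ := h
  -- Invariant: T is the start for j = 0 and the j-th crossing afterwards; the ray then enters the
  -- hexagon moved by `gammaProd s j`, with the remaining crossings ahead.
  have key : ∀ j ≤ k, ∃ T, 0 ≤ T ∧ EntersHexagon θ (gammaProd s j) T ∧ (∀ i < j, t i ≤ T) ∧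
      (∀ i, j ≤ i → i < k → T < t i) ∧
      ∀ i < j, 0 < sectorForm (s i) (planeMap (gammaProd s i) (direction θ)) := by
    intro j
    induction j with
    | zero =>
      refine fun _ => ⟨0, le_rfl, entersHexagon_zero θ, by simp, fun i _ hi => ?_, by simp⟩
      refine (hcross i hi).1.lt_of_ne fun h0 => ?_
      have := (hcross i hi).2
      rw [← h0] at this
      exact not_mem_tessellationSides_of_rayForm_pos (one_mem _) (rayForm_one_pos θ) _ this
    | succ j ih =>
      intro hj
      obtain ⟨T, hT0, hT, hle, hlt, hsec⟩ := ih (by omega)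
      have hg := gammaProd_mem_hexReflectionGroup s j
      have htj := hlt j le_rfl (by omega)
      -- Without an open sector containing the direction, the ray would stay in the open hexagon and
      -- the crossing at `t j` could not occur.
      obtain ⟨m, hm⟩ : ∃ m, 0 < sectorForm m (planeMap (gammaProd s j) (direction θ)) := by
        by_contra! hcon
        exact not_mem_tessellationSides_of_rayForm_pos hg
          (fun i => hT.rayForm_pos (gammaProd_mem_hexStabilizer s j) (hcon i) htj) _
          (hcross j (by omega)).2
      obtain ⟨T', hTT', hmem, huniq, hno, hT'⟩ := hT.exists_exit hg hm
      have hge : T' ≤ t j := by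
        by_contra! hcon
        exact hno _ htj hcon _ (hcross j (by omega)).2
      have heq : T' = t j := by
        rcases hfirst T' (hT0.trans hTT'.le) ⟨m, hmem⟩ with ⟨i, hi, rfl⟩ | hall
        · have hji : ¬ i < j := fun hij => by linarith [hle i hij]
          have : ¬ j < i := fun hij => by linarith [hmono (by simp; omega) (by simpa using hi) hij]
          rw [show i = j by omega]
        · linarith [hall j (by omega)]
      obtain rfl : s j = m := huniq _ (heq ▸ (hcross j (by omega)).2)
      refine ⟨T', hT0.trans hTT'.le, hT', fun i hi => ?_, fun i hi hik => ?_, fun i hi => ?_⟩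
      · rcases Nat.lt_succ_iff_lt_or_eq.1 hi with hi | rfl
        · exact (hle i hi).trans hTT'.le
        · exact heq.ge
      · rw [heq]
        exact hmono (by simp; omega) (by simpa using hik) (by omega)
      · rcases Nat.lt_succ_iff_lt_or_eq.1 hi with hi | rfl
        · exact hsec i hi
        · exact hm
  obtain ⟨-, -, -, -, -, hsec⟩ := key k le_rfl
  exact hsec j hj

/-- If every image of the direction lies in an open sector, then the Teichmüller cutting sequence
is infinite. -/
theorem exists_infinite_teichCutting {θ : ℝ}
    (h : ∀ g ∈ hexReflectionGroup, ∃ i, 0 < sectorForm i (planeMap g (direction θ))) :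
    ∃ s : ℕ → Fin 6, ∀ k, IsTeichCuttingPrefix θ s k := by
  choose! f hf using h
  let G : ℕ → GL (Fin 2) ℝ := fun n => Nat.rec 1 (fun _ g => gammaConj (f g) * g) n
  set s : ℕ → Fin 6 := fun n => f (G n) with hs
  have hG : ∀ n, gammaProd s n = G n := by
    intro n
    induction n with
    | zero => rfl
    | succ n ih => rw [gammaProd, ih]
  have hsec : ∀ n, 0 < sectorForm (s n) (planeMap (gammaProd s n) (direction θ)) := fun n => by
    have := hf _ (gammaProd_mem_hexReflectionGroup s n)
    rwa [hG, ← show s n = f (G n) from rfl, ← hG] at this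
  have hstep : ∀ n T, EntersHexagon θ (gammaProd s n) T → ∃ T', T < T' ∧
      teichRay θ T' ∈ tessellationSides (s n) ∧
      (∀ t, T < t → t < T' → ∀ i, teichRay θ t ∉ tessellationSides i) ∧
      EntersHexagon θ (gammaProd s (n + 1)) T' := fun n T hT => by
    obtain ⟨T', h1, h2, -, h3, h4⟩ :=
      hT.exists_exit (gammaProd_mem_hexReflectionGroup s n) (hsec n)
    exact ⟨T', h1, h2, h3, h4⟩
  choose! next hnext using hstep
  let T : ℕ → ℝ := fun n => Nat.rec 0 next n
  have hT : ∀ n, EntersHexagon θ (gammaProd s n) (T n) := by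
    intro n
    induction n with
    | zero => exact entersHexagon_zero θ
    | succ n ih => exact (hnext n _ ih).2.2.2
  have hlt : ∀ n, T n < T (n + 1) := fun n => (hnext n _ (hT n)).1
  have hmono : StrictMono T := strictMono_nat_of_lt_succ hlt
  -- The shift is needed because `T 0 = 0` is the start of the ray, not a crossing.
  refine ⟨s, fun k => ⟨fun n => T (n + 1), fun a _ b _ hab => hmono (Nat.succ_lt_succ hab), fun j _ => ?_, ?_⟩⟩
  · exact ⟨(hmono (Nat.succ_pos j)).le, (hnext j _ (hT j)).2.1⟩
  · rintro u hu ⟨i, hi⟩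
    have key : ∀ k, (∃ j < k, u = T (j + 1)) ∨ T k < u := by
      intro k
      induction k with
      | zero =>
        right
        refine hu.lt_of_ne ?_
        rintro rfl
        exact not_mem_tessellationSides_of_rayForm_pos (one_mem _) (rayForm_one_pos θ) _ hi
      | succ k ih =>
        rcases ih with ⟨j, hj, h⟩ | h
        · exact Or.inl ⟨j, by omega, h⟩
        · rcases lt_trichotomy u (T (k + 1)) with h' | h' | h'
          · exact absurd hi ((hnext k _ (hT k)).2.2.1 u h h' i)
          · exact Or.inl ⟨k, by omega, h'⟩
          · exact Or.inr h'
    rcases key k with h | h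
    · exact Or.inl h
    · exact Or.inr fun j hj => (hmono.monotone (Nat.succ_le_of_lt hj)).trans_lt h

/-! ### Periodic directions -/

theorem direction_ne_zero (θ : ℝ) : direction θ ≠ 0 := by
  intro h
  have h0 : Real.cos θ = 0 := congrFun h 0
  have h1 : Real.sin θ = 0 := congrFun h 1
  have := Real.sin_sq_add_cos_sq θ
  rw [h0, h1] at this
  norm_num at this

theorem exists_smul_mem_hexLattice {y : Plane} (hy : y ≠ 0) (h : coordA y = 0 ∨ coordB y = 0) :
    ∃ T : ℝ, 0 < T ∧ T • y ∈ hexLattice := by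
  -- Scaling by 3 / |a| gives ±3, which is allowed in either lattice coordinate.
  have habs : ∀ a : ℝ, a ≠ 0 → ∃ e : ℤ, 3 / |a| * a = 3 * e := by
    intro a ha
    rcases lt_or_gt_of_ne ha with h | h
    · exact ⟨-1, by rw [abs_of_neg h]; push_cast; field_simp⟩
    · exact ⟨1, by rw [abs_of_pos h]; push_cast; field_simp⟩
  rcases h with h | h
  · have hB : coordB y ≠ 0 := fun hB => hy (plane_ext_coord (by simp [h]) (by simp [hB]))
    obtain ⟨e, he⟩ := habs _ hB
    exact ⟨3 / |coordB y|, by positivity, (mem_hexLattice_iff _).2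
      ⟨0, 3 * e, by simp [h], by rw [coordB_smul, he]; push_cast; ring⟩⟩
  · have hA : coordA y ≠ 0 := fun hA => hy (plane_ext_coord (by simp [hA]) (by simp [h]))
    obtain ⟨e, he⟩ := habs _ hA
    exact ⟨3 / |coordA y|, by positivity, (mem_hexLattice_iff _).2
      ⟨e, 0, by rw [coordA_smul, he], by simp [h]⟩⟩

/-- A direction on a sector boundary becomes a coordinate axis under ν_i g. A positive multiple of
it then lies in the lattice, and the trajectory closes up. -/
theorem exists_sectorForm_pos_of_not_periodic {θ : ℝ} {p : Plane}
    (h : ¬ IsPeriodicTrajectory (trajectory θ p)) {g : GL (Fin 2) ℝ} (hg : g ∈ hexStabilizer) :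
    ∃ i, 0 < sectorForm i (planeMap g (direction θ)) := by
  obtain ⟨i, hi⟩ := exists_sectorForm_nonneg (planeMap g (direction θ))
  refine ⟨i, hi.lt_of_ne fun h0 => h ?_⟩
  have hmem := mul_mem (nu_mem_hexStabilizer i) hg
  obtain ⟨T, hT, hlat⟩ := exists_smul_mem_hexLattice
    (planeMap_ne_zero (nu i) (planeMap_ne_zero g (direction_ne_zero θ))) (mul_eq_zero.1 h0.symm)
  rw [← planeMap_mul, ← planeMap_smul, hmem.1] at hlat
  refine ⟨T, hT, fun t => ?_⟩
  change toSurface (p + (t + T) • direction θ) = toSurface (p + t • direction θ)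
  rw [toSurface_eq_iff, show p + (t + T) • direction θ - (p + t • direction θ) =
    T • direction θ by module]
  exact hlat

end

theorem mainTheorem4 (θ : ℝ) (p : Plane) (hτ : ∀ t, trajectory θ p t ∉ hexSing)
    (w : ℤ → HexLabel) (hw : IsCuttingSequence hexSide (trajectory θ p) w) :
    (¬ IsPeriodicTrajectory (trajectory θ p) →
      ∃ s : ℕ → Fin 6, ∀ k, IsTeichCuttingPrefix θ s k) ∧
    ∀ (s : ℕ → Fin 6) (k : ℕ), IsTeichCuttingPrefix θ s k →
      (∃ v, IsIteratedDerived k w v) ∧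
      ∃ Ψ : HexSurface ≃ₜ HexSurface,
        IsAffineAutomorphism Ψ (gammaProd s k : Matrix (Fin 2) (Fin 2) ℝ) ∧
        (∀ Φ : HexSurface ≃ₜ HexSurface,
          IsAffineAutomorphism Φ (gammaProd s k : Matrix (Fin 2) (Fin 2) ℝ) → Φ = Ψ) ∧
        ∀ v, IsIteratedDerived k w v →
          IsCuttingSequence (fun L => Ψ.symm '' hexSide L) (trajectory θ p) v := by
  refine ⟨fun h => exists_infinite_teichCutting fun g hg =>
    exists_sectorForm_pos_of_not_periodic h (hexReflectionGroup_le hg), fun s k hs => ?_⟩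
  -- The sector conditions are all that the derivation argument needs from the Teichmüller ray.
  obtain ⟨hex, hcut⟩ := iterated_derivation (p := p) (u := direction θ) hτ hw s k
    hs.sectorForm_pos
  have hg := gammaProd_mem_hexStabilizer s k
  exact ⟨hex, surfaceHomeo _ hg, isAffineAutomorphism_surfaceHomeo hg,
    fun Φ hΦ => affineAutomorphism_unique hΦ (isAffineAutomorphism_surfaceHomeo hg),
    fun v hv => (isCuttingSequence_symm_image _).2 (hcut v hv)⟩
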